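/- For $n\ge 1$ let $$\Omega^{III}_n=\{Z\in M_n(\mathbb C): Z^t=Z,\ I_n-ZZ^*>0\},$$ regarded as a domain in the complex vector space of symmetric $n\times n$ matrices. Two maps $f,g:\Omega_1\to\Omega_2$ between domains are called equivalent if $f=A\circ g\circ B$ for some holomorphic automorphisms $B$ of $\Omega_1$ and $A$ of $\Omega_2$; a map is proper if preimages of compact subsets of the target domain are compact. (1) For every integer $n\ge 1$, with $n'=\tfrac12(n^2+3n-2)$, there is an uncountable set of pairwise inequivalent proper holomorphic maps from $\Omega^{III}_n$ to $\Omega^{III}_{n'}$. (2) For $n=2$ (so $n'=4$) an explicit such family is given as follows. For $0\le t\le 1$ the map $$h_t:\begin{pmatrix} z_1&z_2\\ z_2&z_3\end{pmatrix}\mapsto \begin{pmatrix} z_1^2&\sqrt{2-t}\,z_1z_2&\sqrt{1-t}\,z_2^2&\sqrt t\,z_2\\ \sqrt{2-t}\,z_1z_2&\frac{2(1-t)}{2-t}z_1z_3+z_2^2&2\sqrt{\frac{1-t}{2-t}}\,z_2z_3&\sqrt{\frac{t}{2-t}}\,z_3\\ \sqrt{1-t}\,z_2^2&2\sqrt{\frac{1-t}{2-t}}\,z_2z_3&z_3^2&0\\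 \sqrt t\,z_2&\sqrt{\frac{t}{2-t}}\,z_3&0&0 \end{pmatrix}$$ maps $\Omega^{III}_2$ into $\Omega^{III}_4$, is proper and holomorphic, and $h_s$, $h_t$ are inequivalent whenever $s\ne t$, $s,t\in[0,1]$. -/

import Mathlib

open scoped ComplexOrder Matrix

/-- The complex vector space of symmetric complex `n × n` matrices. -/
def SymMat (n : ℕ) : Submodule ℂ (Matrix (Fin n) (Fin n) ℂ) where
  carrier := {Z | Zᵀ = Z}
  add_mem' := by
    intro a b ha hb
    simp only [Set.mem_ofPred_eq] at ha hb ⊢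
    rw [Matrix.transpose_add, ha, hb]
  zero_mem' := by simp
  smul_mem' := by
    intro c a ha
    simp only [Set.mem_ofPred_eq] at ha ⊢
    rw [Matrix.transpose_smul, ha]

/-- The classical domain of type III, as an open subset of the space of symmetric matrices:
all `Z` with `Zᵀ = Z` and `I - Z Z*` positive definite. -/
def OmegaIII (n : ℕ) : Set (SymMat n) :=
  {Z | (1 - (Z : Matrix (Fin n) (Fin n) ℂ) * (Z : Matrix (Fin n) (Fin n) ℂ)ᴴ).PosDef}

section Maps

variable {E F : Type*} [AddCommGroup E] [Module ℂ E] [TopologicalSpace E]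
  [AddCommGroup F] [Module ℂ F] [TopologicalSpace F]

/-- A map between domains `D ⊆ E` and `D' ⊆ F` is holomorphic if it is complex differentiable
on `D` (as a map into the ambient space of `D'`). -/
def IsHolomorphicMap {D : Set E} {D' : Set F} (f : D → D') : Prop :=
  ∃ g : E → F, DifferentiableOn ℂ g D ∧ ∀ z : D, g z = f z

/-- A map between domains is proper if preimages of compact sets are compact. -/
def IsProperBetween {D : Set E} {D' : Set F} (f : D → D') : Prop :=
  ∀ K : Set D', IsCompact K → IsCompact (f ⁻¹' K)

/-- Holomorphic automorphisms of a domain: bijections that are holomorphic with holomorphic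
inverse. -/
def IsHolomorphicAut {D : Set E} (A : D ≃ D) : Prop :=
  IsHolomorphicMap A ∧ IsHolomorphicMap A.symm

/-- `f` and `g` are equivalent if `f = A ∘ g ∘ B` with `B` an automorphism of the source and `A`
an automorphism of the target. -/
def HolEquivalent {D : Set E} {D' : Set F} (f g : D → D') : Prop :=
  ∃ (B : D ≃ D) (A : D' ≃ D'), IsHolomorphicAut B ∧ IsHolomorphicAut A ∧ f = A ∘ g ∘ B

end Maps

/-- The quadratic polynomial map `f_t` from `2 × 2` matrices to `4 × 4` matrices. -/
noncomputable def fMap (t : ℝ) (Z : Matrix (Fin 2) (Fin 2) ℂ) : Matrix (Fin 4) (Fin 4) ℂ :=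
  let z₁ := Z 0 0
  let z₂ := Z 0 1
  let z₃ := Z 1 0
  let z₄ := Z 1 1
  let a : ℂ := (Real.sqrt (2 - t) : ℝ)
  let b : ℂ := (Real.sqrt (1 - t) : ℝ)
  let c : ℂ := (Real.sqrt t : ℝ)
  let d : ℂ := (2 * (1 - t) / (2 - t) : ℝ)
  let e : ℂ := (2 * Real.sqrt ((1 - t) / (2 - t)) : ℝ)
  let k : ℂ := (Real.sqrt (t / (2 - t)) : ℝ)
  !![z₁ ^ 2,      a * z₁ * z₂,               b * z₂ ^ 2,  c * z₂;
     a * z₁ * z₃, d * z₁ * z₄ + z₂ * z₃,     e * z₂ * z₄, k * z₄;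
     b * z₃ ^ 2,  e * z₃ * z₄,               z₄ ^ 2,      0;
     c * z₃,      k * z₄,                    0,           0]

/-! The domain `OmegaIII n` is the open unit ball of the operator norm on symmetric matrices. A map
into it that is continuous up to the sphere is proper as soon as it sends no unit sphere point into
the target. To check this, a symmetric `Z` of norm one has a Takagi vector `v ≠ 0` with `Z v = star
v`; from `v` one builds a nonzero vector that the image matrix does not shorten.

For `n ≥ 2` inequivalence comes from one invariant. Automorphisms have injective derivatives, so in
`f = A ∘ g ∘ B` the map `B` carries critical points (where the derivative is not injective) to
critical points. If the origin is the only critical point of both maps and both fix it, then `B` and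
`A` fix the origin, the Schwarz lemma bounds their derivatives there by one, and the derivatives of
`f` and `g` at the origin have equal operator norm (`HolEquivalent.norm_fderiv_eq`).

In the explicit family this norm is `√t` for `t < 1`; the endpoint `t = 1` is separated because it
has further critical points. For general `n ≥ 2` the maps send `Z` to its symmetric square plus a
scalar block `t Z₀₀` of size `n - 1`, and the norm is `t`. The sizes add up: `n(n+1)/2 + (n-1) =
(n²+3n-2)/2`.

For `n = 1` source and target are the disc and there is no room for a scalar block. The Blaschke
products `z³(z-a)/(1-az)` serve instead: the origin is the only point where the first two
derivatives vanish, so an equivalence fixes it and carries the simple zero `a` to the simple zero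
`c`; the Schwarz lemma in both directions gives `a = c`. -/

/-! ### The domain as a ball, Takagi vectors, and a criterion for properness -/

section Domain

open scoped Matrix.Norms.L2Operator

/-- The squared Euclidean norm of a complex vector. -/
noncomputable def sqNorm {ι : Type*} [Fintype ι] (x : ι → ℂ) : ℝ := ∑ i, ‖x i‖ ^ 2

variable {ι κ : Type*} [Fintype ι] [Fintype κ]

lemma sqNorm_eq (x : ι → ℂ) : sqNorm x = ‖WithLp.toLp 2 x‖ ^ 2 := by
  rw [EuclideanSpace.norm_sq_eq]; rfl

lemma sqNorm_nonneg (x : ι → ℂ) : 0 ≤ sqNorm x := Finset.sum_nonneg fun _ _ => by positivity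

lemma sqNorm_eq_zero {x : ι → ℂ} : sqNorm x = 0 ↔ x = 0 := by
  rw [sqNorm, Finset.sum_eq_zero_iff_of_nonneg fun _ _ => by positivity]
  simp [funext_iff]

lemma sqNorm_pos {x : ι → ℂ} (hx : x ≠ 0) : 0 < sqNorm x :=
  lt_of_le_of_ne (sqNorm_nonneg x) fun h => hx (sqNorm_eq_zero.1 h.symm)

lemma sqNorm_star (x : ι → ℂ) : sqNorm (star x) = sqNorm x := by
  simp [sqNorm]

lemma star_dotProduct_self (x : ι → ℂ) : star x ⬝ᵥ x = (sqNorm x : ℂ) := by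
  simp [dotProduct, sqNorm, Complex.conj_mul']

lemma norm_mulVec_le [DecidableEq ι] (A : Matrix κ ι ℂ) (x : ι → ℂ) :
    sqNorm (A *ᵥ x) ≤ ‖A‖ ^ 2 * sqNorm x := by
  rw [sqNorm_eq, sqNorm_eq, ← mul_pow]
  have := A.l2_opNorm_mulVec (WithLp.toLp 2 x)
  exact pow_le_pow_left₀ (norm_nonneg _) this 2

/-- The unit ball is compact in finite dimension, so the operator norm is attained and the pointwise
strict inequality survives the supremum. -/
lemma norm_lt_one_of_sqNorm_mulVec_lt [DecidableEq ι] (A : Matrix ι ι ℂ)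
    (h : ∀ x, x ≠ 0 → sqNorm (A *ᵥ x) < sqNorm x) : ‖A‖ < 1 := by
  rw [Matrix.cstar_norm_def]
  set T := Matrix.toEuclideanCLM (n := ι) (𝕜 := ℂ) A with hT
  have hlt : ∀ x, x ≠ 0 → ‖T x‖ < ‖x‖ := by
    intro x hx
    have := h x.ofLp (by simpa using hx)
    rw [sqNorm_eq, sqNorm_eq] at this
    exact lt_of_pow_lt_pow_left₀ 2 (norm_nonneg _) this
  obtain ⟨x, hx, hmax⟩ := (isCompact_closedBall (0 : EuclideanSpace ℂ ι) 1).exists_isMaxOn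
    ⟨0, by simp⟩ (f := fun x => ‖T x‖) (by fun_prop)
  have hle : ‖T‖ ≤ ‖T x‖ := by
    refine ContinuousLinearMap.opNorm_le_of_unit_norm (norm_nonneg _) fun y hy => ?_
    exact hmax (by simp [hy])
  by_cases hx0 : x = 0
  · subst hx0
    simp at hle
    simp [hle]
  · have := hlt x hx0
    simp at hx
    linarith

/-- Symmetry makes the adjoint of `Z` its entrywise conjugate. Consequently `Zᴴ Z` is the square of
the antilinear map `x ↦ star (Z x)`, which is what produces Takagi vectors. -/
lemma star_mulVec_of_symm {n : ℕ} (Z : SymMat n) (x : Fin n → ℂ) :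
    (Z : Matrix (Fin n) (Fin n) ℂ)ᴴ *ᵥ x = star ((Z : Matrix (Fin n) (Fin n) ℂ) *ᵥ star x) := by
  have hZ : (Z : Matrix (Fin n) (Fin n) ℂ)ᵀ = Z := Z.2
  have : (Z : Matrix (Fin n) (Fin n) ℂ)ᴴ = (Z : Matrix (Fin n) (Fin n) ℂ).map star := by
    rw [Matrix.conjTranspose, hZ]
  rw [this]
  ext i
  simp [Matrix.mulVec, dotProduct]

/-- Membership in the type III domain: `Z` strictly decreases the Euclidean length. -/
lemma mem_OmegaIII_iff {n : ℕ} {Z : SymMat n} :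
    Z ∈ OmegaIII n ↔
      ∀ x, x ≠ 0 → sqNorm ((Z : Matrix (Fin n) (Fin n) ℂ) *ᵥ x) < sqNorm x := by
  set M : Matrix (Fin n) (Fin n) ℂ := Z.1 with hM
  have key : ∀ x : Fin n → ℂ,
      star x ⬝ᵥ ((1 - M * Mᴴ) *ᵥ x) = ((sqNorm x - sqNorm (M *ᵥ star x) : ℝ) : ℂ) := by
    intro x
    rw [Matrix.sub_mulVec, Matrix.one_mulVec, dotProduct_sub, star_dotProduct_self,
      ← Matrix.mulVec_mulVec, Matrix.dotProduct_mulVec]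
    have : star x ᵥ* M = star (Mᴴ *ᵥ x) := by
      rw [Matrix.star_mulVec, Matrix.conjTranspose_conjTranspose]
    rw [this, star_dotProduct_self, star_mulVec_of_symm, sqNorm_star]
    push_cast; rfl
  have hH : (1 - M * Mᴴ).IsHermitian := by
    rw [Matrix.IsHermitian, Matrix.conjTranspose_sub, Matrix.conjTranspose_mul]
    simp
  change (1 - M * Mᴴ).PosDef ↔ _
  rw [Matrix.posDef_iff_dotProduct_mulVec]
  constructor
  · rintro ⟨-, h⟩ x hx
    have := h (x := star x) (by simpa using hx)
    rw [key, star_star, sqNorm_star] at this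
    have := Complex.zero_lt_real.1 this
    linarith
  · intro h
    refine ⟨hH, fun x hx => ?_⟩
    rw [key]
    refine Complex.zero_lt_real.2 ?_
    have := h (star x) (by simpa using hx)
    rw [sqNorm_star] at this
    linarith

lemma mem_OmegaIII_iff_norm {n : ℕ} {Z : SymMat n} : Z ∈ OmegaIII n ↔ ‖Z‖ < 1 := by
  rw [mem_OmegaIII_iff]
  constructor
  · exact norm_lt_one_of_sqNorm_mulVec_lt _
  · intro h x hx
    have h1 := norm_mulVec_le (Z : Matrix (Fin n) (Fin n) ℂ) x
    have h2 : ‖(Z : Matrix (Fin n) (Fin n) ℂ)‖ ^ 2 < 1 := by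
      have : ‖(Z : Matrix (Fin n) (Fin n) ℂ)‖ < 1 := h
      have := norm_nonneg (Z : Matrix (Fin n) (Fin n) ℂ)
      nlinarith
    nlinarith [sqNorm_pos hx]

lemma OmegaIII_eq_ball (n : ℕ) : OmegaIII n = Metric.ball (0 : SymMat n) 1 := by
  ext Z; rw [mem_OmegaIII_iff_norm, mem_ball_zero_iff]

/-- A symmetric matrix of operator norm one has a unit eigenvector in the sense of Takagi. -/
lemma exists_mulVec_eq_star {n : ℕ} {Z : SymMat n} (hZ : ‖Z‖ = 1) :
    ∃ v, v ≠ 0 ∧ (Z : Matrix (Fin n) (Fin n) ℂ) *ᵥ v = star v := by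
  have hmem : Z ∉ OmegaIII n := by rw [mem_OmegaIII_iff_norm, hZ]; exact lt_irrefl _
  rw [mem_OmegaIII_iff] at hmem
  push Not at hmem
  obtain ⟨w, hw0, hw⟩ := hmem
  set M : Matrix (Fin n) (Fin n) ℂ := Z.1 with hM
  have hle : ∀ x, sqNorm (M *ᵥ x) ≤ sqNorm x := by
    intro x
    have h1 := norm_mulVec_le M x
    have h2 : ‖M‖ = 1 := hZ
    rw [h2] at h1; simpa using h1
  -- `Mᴴ M w = w`
  have hfix : Mᴴ *ᵥ (M *ᵥ w) = w := by
    rw [← sub_eq_zero, ← sqNorm_eq_zero]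
    refine le_antisymm ?_ (sqNorm_nonneg _)
    have hadj : ∀ x, sqNorm (Mᴴ *ᵥ x) ≤ sqNorm x := by
      intro x
      rw [star_mulVec_of_symm, sqNorm_star, ← sqNorm_star x]
      exact hle _
    -- As `Mᴴ` is a contraction, this expansion is at most `sqNorm w - sqNorm (M w)`, which is
    -- nonpositive by the choice of `w`.
    have e : ((sqNorm (Mᴴ *ᵥ (M *ᵥ w) - w) : ℝ) : ℂ) =
        ((sqNorm (Mᴴ *ᵥ (M *ᵥ w)) - 2 * sqNorm (M *ᵥ w) + sqNorm w : ℝ) : ℂ) := by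
      have h1 : star w ⬝ᵥ (Mᴴ *ᵥ (M *ᵥ w)) = (sqNorm (M *ᵥ w) : ℂ) := by
        rw [Matrix.dotProduct_mulVec, ← Matrix.star_mulVec, star_dotProduct_self]
      have h2 : star (Mᴴ *ᵥ (M *ᵥ w)) ⬝ᵥ w = (sqNorm (M *ᵥ w) : ℂ) := by
        rw [Matrix.star_mulVec, Matrix.conjTranspose_conjTranspose, ← Matrix.dotProduct_mulVec,
          star_dotProduct_self]
      rw [← star_dotProduct_self, star_sub, sub_dotProduct, dotProduct_sub, dotProduct_sub, h1, h2,
        star_dotProduct_self, star_dotProduct_self]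
      push_cast; ring
    have e' := Complex.ofReal_injective e
    have := hadj (M *ᵥ w)
    linarith
  rw [star_mulVec_of_symm] at hfix
  have hfix' : M *ᵥ star (M *ᵥ w) = star w := by simpa using congrArg star hfix
  -- The antilinear map `T x = star (M x)` satisfies `T (T w) = w`, so `w + T w` is fixed by `T`. If
  -- that sum vanishes, then `T w = -w` and `Complex.I • w` is fixed.
  by_cases hv : w + star (M *ᵥ w) = 0
  · refine ⟨Complex.I • w, by simpa using hw0, ?_⟩
    have : M *ᵥ w = - star w := by
      have := congrArg star (eq_neg_of_add_eq_zero_right hv)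
      simpa using this
    rw [Matrix.mulVec_smul, this]
    ext i; simp
  · refine ⟨_, hv, ?_⟩
    rw [Matrix.mulVec_add, hfix', star_add, star_star, add_comm]

lemma notMem_OmegaIII_of_le {n : ℕ} {Z : SymMat n} {x : Fin n → ℂ} (hx : x ≠ 0)
    (h : sqNorm x ≤ sqNorm ((Z : Matrix (Fin n) (Fin n) ℂ) *ᵥ x)) : Z ∉ OmegaIII n := by
  rw [mem_OmegaIII_iff]
  exact fun hh => absurd (hh x hx) (not_lt.2 h)

/-- A map of balls extending continuously to the closed ball, with the sphere avoiding the target,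
is proper. -/
lemma isProperBetween_of_boundary {n m : ℕ} {f : OmegaIII n → OmegaIII m} (F : SymMat n → SymMat m)
    (hF : ContinuousOn F (Metric.closedBall 0 1)) (hb : ∀ Z, ‖Z‖ = 1 → F Z ∉ OmegaIII m)
    (hf : ∀ Z : OmegaIII n, F Z = f Z) : IsProperBetween f := by
  intro K hK
  have hK' : IsCompact ((↑) '' K : Set (SymMat m)) := hK.image continuous_subtype_val
  -- This set is compact in the closed ball and, by `hb`, misses the sphere, so it is the preimage
  -- of `K` in the open ball.
  have hC : IsCompact (Metric.closedBall (0 : SymMat n) 1 ∩ F ⁻¹' ((↑) '' K)) :=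
    (isCompact_closedBall _ _).of_isClosed_subset
      (hF.preimage_isClosed_of_isClosed Metric.isClosed_closedBall hK'.isClosed)
      Set.inter_subset_left
  rw [Topology.IsInducing.subtypeVal.isCompact_iff]
  convert! hC using 1
  ext Z
  constructor
  · rintro ⟨Z, hZ, rfl⟩
    have := mem_OmegaIII_iff_norm.1 Z.2
    exact ⟨by simpa using this.le, ⟨f Z, hZ, (hf Z).symm⟩⟩
  · rintro ⟨h1, ⟨W, hW, hWZ⟩⟩
    have hle : ‖Z‖ ≤ 1 := by simpa using h1
    have hne : ‖Z‖ ≠ 1 := fun h => hb Z h (hWZ ▸ W.2)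
    have hZ : Z ∈ OmegaIII n := mem_OmegaIII_iff_norm.2 (lt_of_le_of_ne hle hne)
    refine ⟨⟨Z, hZ⟩, ?_, rfl⟩
    have : f ⟨Z, hZ⟩ = W := Subtype.ext (by rw [← hf ⟨Z, hZ⟩, hWZ])
    simpa [this] using hW

end Domain

/-! ### Invariants of equivalence: critical points and the derivative at the origin -/

section Invariance

open scoped Matrix.Norms.L2Operator

lemma isOpen_OmegaIII (n : ℕ) : IsOpen (OmegaIII n) := by
  rw [OmegaIII_eq_ball]; exact Metric.isOpen_ball

lemma zero_mem_OmegaIII (n : ℕ) : (0 : SymMat n) ∈ OmegaIII n := by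
  rw [mem_OmegaIII_iff_norm]; simp

/-- A holomorphic automorphism extends to a map with injective derivatives on the domain, which
at a fixed origin is a contraction. -/
lemma IsHolomorphicAut.exists_extension {n : ℕ} {A : OmegaIII n ≃ OmegaIII n}
    (hA : IsHolomorphicAut A) :
    ∃ g : SymMat n → SymMat n, DifferentiableOn ℂ g (OmegaIII n) ∧ (∀ z : OmegaIII n, g z = A z) ∧
      (∀ z : OmegaIII n, Function.Injective (fderiv ℂ g z)) ∧
      (g 0 = 0 → ‖fderiv ℂ g 0‖ ≤ 1) := by
  obtain ⟨⟨g, hg, hgA⟩, ⟨k, hk, hkA⟩⟩ := hA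
  refine ⟨g, hg, hgA, fun z => ?_, fun h0 => ?_⟩
  · have h1 : DifferentiableAt ℂ g z := hg.differentiableAt ((isOpen_OmegaIII n).mem_nhds z.2)
    have h2 : DifferentiableAt ℂ k (g z) := by
      rw [hgA]; exact hk.differentiableAt ((isOpen_OmegaIII n).mem_nhds (A z).2)
    -- Differentiating this local left inverse exhibits a left inverse of the derivative of `g`.
    have h3 : k ∘ g =ᶠ[nhds (z : SymMat n)] id := by
      filter_upwards [(isOpen_OmegaIII n).mem_nhds z.2] with w hw
      have := hgA ⟨w, hw⟩
      simp only at this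
      rw [Function.comp_apply, this, hkA]; simp
    have h4 := fderiv_comp (z : SymMat n) h2 h1
    rw [h3.fderiv_eq, fderiv_id] at h4
    intro x y hxy
    have e1 := congrArg (fun L => L x) h4
    have e2 := congrArg (fun L => L y) h4
    simp only [ContinuousLinearMap.comp_apply, ContinuousLinearMap.id_apply] at e1 e2
    rw [e1, e2, hxy]
  · refine Complex.norm_fderiv_le_one_of_mapsTo_ball (R := 1) (c := 0) ?_ ?_ one_pos
    · rwa [← OmegaIII_eq_ball]
    · rw [h0, ← OmegaIII_eq_ball]
      intro z hz
      have := hgA ⟨z, hz⟩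
      simp only at this
      rw [this]
      exact Metric.ball_subset_closedBall (OmegaIII_eq_ball n ▸ (A ⟨z, hz⟩).2)

variable {n m : ℕ}

lemma HolEquivalent.refl (f : OmegaIII n → OmegaIII m) : HolEquivalent f f :=
  ⟨Equiv.refl _, Equiv.refl _,
    ⟨⟨id, differentiableOn_id, fun _ => rfl⟩, ⟨id, differentiableOn_id, fun _ => rfl⟩⟩,
    ⟨⟨id, differentiableOn_id, fun _ => rfl⟩, ⟨id, differentiableOn_id, fun _ => rfl⟩⟩, rfl⟩

/-- A family with uncountable index type whose members are inequivalent gives an uncountable set. -/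
lemma exists_uncountable_of_family {T : Type*} (h : T → OmegaIII n → OmegaIII m)
    (hT : ¬ Countable T) (hh : ∀ t, IsHolomorphicMap (h t) ∧ IsProperBetween (h t))
    (hne : ∀ s t, HolEquivalent (h s) (h t) → s = t) :
    ∃ S : Set (OmegaIII n → OmegaIII m), ¬ S.Countable ∧
      (∀ f ∈ S, IsHolomorphicMap f ∧ IsProperBetween f) ∧
      S.Pairwise (fun f g => ¬ HolEquivalent f g) := by
  have hinj : Function.Injective h := fun s t hst => hne s t (hst ▸ HolEquivalent.refl _)
  refine ⟨Set.range h, fun hc => hT ?_, ?_, ?_⟩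
  · have := hc.to_subtype
    exact (Set.rangeFactorization_injective.2 hinj).countable
  · rintro _ ⟨t, rfl⟩
    exact hh t
  · rintro _ ⟨s, rfl⟩ _ ⟨t, rfl⟩ hst he
    exact hst (congrArg h (hne s t he))

lemma HolEquivalent.symm {f g : OmegaIII n → OmegaIII m} (h : HolEquivalent f g) :
    HolEquivalent g f := by
  obtain ⟨B, A, hB, hA, rfl⟩ := h
  refine ⟨B.symm, A.symm, ⟨hB.2, by simpa using hB.1⟩, ⟨hA.2, by simpa using hA.1⟩, ?_⟩
  ext z; simp

/-- Equivalent maps have corresponding critical points, and the same norm of the derivative at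
the origin, when the origin is fixed throughout. -/
lemma HolEquivalent.exists_fderiv {f g : OmegaIII n → OmegaIII m} (h : HolEquivalent f g)
    {F G : SymMat n → SymMat m} (hF : ∀ z : OmegaIII n, F z = f z)
    (hG : ∀ z : OmegaIII n, G z = g z) (dG : DifferentiableOn ℂ G (OmegaIII n)) :
    ∃ B : OmegaIII n ≃ OmegaIII n,
      (∀ z : OmegaIII n, Function.Injective (fderiv ℂ G (B z)) →
        Function.Injective (fderiv ℂ F z)) ∧
      (∀ z : OmegaIII n, (z : SymMat n) = 0 → (B z : SymMat n) = 0 → F 0 = 0 → G 0 = 0 →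
        ‖fderiv ℂ F 0‖ ≤ ‖fderiv ℂ G 0‖) := by
  obtain ⟨B, A, hB, hA, rfl⟩ := h
  obtain ⟨a, da, haA, ia, na⟩ := hA.exists_extension
  obtain ⟨b, db, hbB, ib, nb⟩ := hB.exists_extension
  have chain : ∀ z : OmegaIII n, fderiv ℂ F z =
      (fderiv ℂ a (g (B z))).comp ((fderiv ℂ G (B z)).comp (fderiv ℂ b z)) := by
    intro z
    have h3 : F =ᶠ[nhds (z : SymMat n)] a ∘ (G ∘ b) := by
      filter_upwards [(isOpen_OmegaIII n).mem_nhds z.2] with w hw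
      have e1 := hF ⟨w, hw⟩
      have e2 := hbB ⟨w, hw⟩
      simp only at e1 e2
      change F w = a (G (b w))
      rw [e1, e2, hG, haA]
      rfl
    have h1 : DifferentiableAt ℂ b z := db.differentiableAt ((isOpen_OmegaIII n).mem_nhds z.2)
    have h2 : DifferentiableAt ℂ G (b z) := by
      rw [hbB]; exact dG.differentiableAt ((isOpen_OmegaIII n).mem_nhds (B z).2)
    have h4 : DifferentiableAt ℂ a ((G ∘ b) z) := by
      rw [Function.comp_apply, hbB, hG]
      exact da.differentiableAt ((isOpen_OmegaIII m).mem_nhds (g (B z)).2)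
    rw [h3.fderiv_eq, fderiv_comp _ h4 (h2.comp _ h1), fderiv_comp _ h2 h1, Function.comp_apply,
      hbB, hG]
  refine ⟨B, fun z hz => ?_, fun z hz hBz hF0 hG0 => ?_⟩
  · rw [chain z]
    exact (ia _).comp (hz.comp (ib z))
  · have c := chain z
    have eg : (g (B z) : SymMat m) = 0 := by rw [← hG, hBz, hG0]
    have ef : (A (g (B z)) : SymMat m) = 0 := by
      have := hF z
      rw [hz, hF0] at this
      exact this.symm
    -- Since `B` fixes the origin and both maps vanish there, `A` fixes the origin as well, which
    -- makes the Schwarz bound available for both automorphisms.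
    have a0 : a 0 = 0 := by rw [← eg, haA, ef, eg]
    have b0 : b 0 = 0 := by
      have := hbB z
      rw [hz, hBz] at this
      exact this
    rw [eg, hBz, hz] at c
    rw [c]
    have n1 := na a0
    have n2 := nb b0
    calc _ ≤ ‖fderiv ℂ a 0‖ * (‖fderiv ℂ G 0‖ * ‖fderiv ℂ b 0‖) :=
          (ContinuousLinearMap.opNorm_comp_le _ _).trans
            (mul_le_mul_of_nonneg_left (ContinuousLinearMap.opNorm_comp_le _ _) (norm_nonneg _))
      _ ≤ 1 * (‖fderiv ℂ G 0‖ * 1) := by gcongr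
      _ = _ := by ring

/-- Two maps whose only critical point is the origin, which they fix, have derivatives of the same
norm there if they are equivalent. -/
lemma HolEquivalent.norm_fderiv_eq {f g : OmegaIII n → OmegaIII m} (h : HolEquivalent f g)
    {F G : SymMat n → SymMat m} (hF : ∀ z : OmegaIII n, F z = f z)
    (hG : ∀ z : OmegaIII n, G z = g z) (dF : DifferentiableOn ℂ F (OmegaIII n))
    (dG : DifferentiableOn ℂ G (OmegaIII n)) (hF0 : F 0 = 0) (hG0 : G 0 = 0)
    (cF : ∀ z, Function.Injective (fderiv ℂ F z) ↔ z ≠ 0)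
    (cG : ∀ z, Function.Injective (fderiv ℂ G z) ↔ z ≠ 0) :
    ‖fderiv ℂ F 0‖ = ‖fderiv ℂ G 0‖ := by
  refine le_antisymm ?_ ?_
  · obtain ⟨B, h1, h2⟩ := h.exists_fderiv hF hG dG
    refine h2 ⟨0, zero_mem_OmegaIII n⟩ rfl ?_ hF0 hG0
    -- If `B` moved the origin, `G` would be immersive at its image, hence `F` at the origin,
    -- contradicting `cF`.
    by_contra hne
    exact (cF 0).1 (h1 ⟨0, zero_mem_OmegaIII n⟩ ((cG _).2 hne)) rfl
  · obtain ⟨B, h1, h2⟩ := h.symm.exists_fderiv hG hF dF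
    refine h2 ⟨0, zero_mem_OmegaIII n⟩ rfl ?_ hG0 hF0
    by_contra hne
    exact (cG 0).1 (h1 ⟨0, zero_mem_OmegaIII n⟩ ((cF _).2 hne)) rfl

/-- A map with a critical point besides the origin is not equivalent to one without. -/
lemma not_holEquivalent_of_critical {f g : OmegaIII n → OmegaIII m}
    {F G : SymMat n → SymMat m} (hF : ∀ z : OmegaIII n, F z = f z)
    (hG : ∀ z : OmegaIII n, G z = g z) (dG : DifferentiableOn ℂ G (OmegaIII n))
    (cF : ¬ Function.Injective (fderiv ℂ F 0)) {p : SymMat n} (hp : p ∈ OmegaIII n) (hp0 : p ≠ 0)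
    (cFp : ¬ Function.Injective (fderiv ℂ F p))
    (cG : ∀ z, Function.Injective (fderiv ℂ G z) ↔ z ≠ 0) : ¬ HolEquivalent f g := by
  intro h
  obtain ⟨B, h1, -⟩ := h.exists_fderiv hF hG dG
  have e1 : (B ⟨0, zero_mem_OmegaIII n⟩ : SymMat n) = 0 := by
    by_contra hne
    exact cF (h1 ⟨0, zero_mem_OmegaIII n⟩ ((cG _).2 hne))
  have e2 : (B ⟨p, hp⟩ : SymMat n) = 0 := by
    by_contra hne
    exact cFp (h1 ⟨p, hp⟩ ((cG _).2 hne))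
  have := B.injective (Subtype.ext (e1.trans e2.symm))
  exact hp0 (congrArg Subtype.val this).symm

end Invariance

/-! ### Entrywise differentiability, derivatives of quadratic maps, norm bounds -/

section Calculus

open scoped Matrix.Norms.L2Operator

/-- The linear projection of matrices onto symmetric matrices. -/
noncomputable def symPart (m : ℕ) : Matrix (Fin m) (Fin m) ℂ →ₗ[ℂ] SymMat m where
  toFun M := ⟨(1 / 2 : ℂ) • (M + Mᵀ), by
    change ((1 / 2 : ℂ) • (M + Mᵀ))ᵀ = _
    rw [Matrix.transpose_smul, Matrix.transpose_add, Matrix.transpose_transpose, add_comm]⟩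
  map_add' M N := Subtype.ext <| by
    simp only [Matrix.transpose_add, Submodule.coe_add]; module
  map_smul' c M := Subtype.ext <| by
    simp only [Matrix.transpose_smul, Submodule.coe_smul, RingHom.id_apply]; module

lemma symPart_coe {m : ℕ} (Z : SymMat m) : symPart m Z = Z := by
  have hZ : (Z : Matrix (Fin m) (Fin m) ℂ)ᵀ = Z := Z.2
  refine Subtype.ext ?_
  change (1 / 2 : ℂ) • ((Z : Matrix (Fin m) (Fin m) ℂ) + (Z : Matrix (Fin m) (Fin m) ℂ)ᵀ) = _
  rw [hZ]; module

lemma SymMat.ext_entry {m : ℕ} {Z W : SymMat m} (h : ∀ i j, Z.1 i j = W.1 i j) : Z = W :=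
  Subtype.ext (by ext i j; exact h i j)

lemma SymMat.apply_comm {m : ℕ} (Z : SymMat m) (i j : Fin m) : Z.1 i j = Z.1 j i :=
  congrFun (congrFun (Z.2 : Z.1ᵀ = Z.1) j) i

/-- The `(i, j)` entry as a continuous linear functional on symmetric matrices. -/
noncomputable def entryCLM {n : ℕ} (i j : Fin n) : SymMat n →L[ℂ] ℂ :=
  LinearMap.toContinuousLinearMap
    { toFun := fun Z => Z.1 i j, map_add' := fun _ _ => rfl, map_smul' := fun _ _ => rfl }

lemma entryCLM_apply {n : ℕ} (i j : Fin n) (Z : SymMat n) : entryCLM i j Z = Z.1 i j := rfl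

@[fun_prop]
lemma differentiable_entryCLM {n : ℕ} (i j : Fin n) :
    Differentiable ℂ fun Z : SymMat n => entryCLM i j Z := (entryCLM i j).differentiable

/-- A map into symmetric matrices is differentiable if its entries are. -/
lemma differentiableOn_of_entry {E : Type*} [NormedAddCommGroup E] [NormedSpace ℂ E] {m : ℕ}
    {s : Set E} {F : E → SymMat m} (h : ∀ i j, DifferentiableOn ℂ (fun Z => (F Z).1 i j) s) :
    DifferentiableOn ℂ F s := by
  -- `symPart` is a linear left inverse of the inclusion, so `F` factors through the full matrix
  -- space, where it is a finite sum of its entries times constants.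
  have e : F = fun Z => (LinearMap.toContinuousLinearMap (symPart m))
      (∑ i, ∑ j, (F Z).1 i j • Matrix.single i j (1 : ℂ)) := by
    funext Z
    have : (∑ i, ∑ j, (F Z).1 i j • Matrix.single i j (1 : ℂ)) = (F Z).1 := by
      conv_rhs => rw [Matrix.matrix_eq_sum_single (F Z).1]
      simp
    rw [this]
    exact (symPart_coe _).symm
  rw [e]
  refine (ContinuousLinearMap.differentiable _).comp_differentiableOn ?_
  refine DifferentiableOn.fun_sum fun i _ => DifferentiableOn.fun_sum fun j _ => ?_
  exact (h i j).smul_const _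

/-- The derivative of a map that is quadratic along a line. -/
lemma fderiv_apply_of_quadratic {E F : Type*} [NormedAddCommGroup E] [NormedSpace ℂ E]
    [NormedAddCommGroup F] [NormedSpace ℂ F] {f : E → F} {z h : E} {d q : F}
    (hf : DifferentiableAt ℂ f z) (e : ∀ c : ℂ, f (z + c • h) = f z + c • d + (c ^ 2) • q) :
    fderiv ℂ f z h = d := by
  have h1 : HasDerivAt (fun c : ℂ => z + c • h) h 0 := by
    simpa using ((hasDerivAt_id (0 : ℂ)).smul_const h).const_add z
  have h2 : HasDerivAt (fun c : ℂ => f (z + c • h)) (fderiv ℂ f z h) 0 := by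
    refine HasFDerivAt.comp_hasDerivAt (0 : ℂ) (l := f) ?_ h1
    simpa using hf.hasFDerivAt
  have h3 : HasDerivAt (fun c : ℂ => f (z + c • h)) d 0 := by
    simp_rw [e]
    have a := ((hasDerivAt_id (0 : ℂ)).smul_const d).const_add (f z)
    have b := (((hasDerivAt_id (0 : ℂ)).pow 2).smul_const q)
    convert! a.add b using 1
    simp
  exact h2.unique h3

lemma norm_le_of_sqNorm_mulVec_le {n : ℕ} (Z : SymMat n) {r : ℝ} (hr : 0 ≤ r)
    (h : ∀ x, sqNorm (Z.1 *ᵥ x) ≤ r ^ 2 * sqNorm x) : ‖Z‖ ≤ r := by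
  change ‖Z.1‖ ≤ r
  rw [Matrix.cstar_norm_def]
  refine ContinuousLinearMap.opNorm_le_bound _ hr fun x => ?_
  have := h x.ofLp
  rw [sqNorm_eq, sqNorm_eq, ← mul_pow] at this
  exact (sq_le_sq₀ (norm_nonneg _) (by positivity)).1 this

lemma le_norm_of_le_sqNorm_mulVec {n : ℕ} (Z : SymMat n) {r : ℝ} {x : Fin n → ℂ} (hx : x ≠ 0)
    (h : r ^ 2 * sqNorm x ≤ sqNorm (Z.1 *ᵥ x)) : r ≤ ‖Z‖ := by
  have h1 := norm_mulVec_le Z.1 x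
  have h2 : r ^ 2 ≤ ‖Z.1‖ ^ 2 := le_of_mul_le_mul_right (h.trans h1) (sqNorm_pos hx)
  exact (le_abs_self r).trans (abs_le_of_sq_le_sq h2 (norm_nonneg _))

end Calculus

/-! ### The explicit family from size 2 to size 4: values in the domain, boundary behaviour -/

section QuadraticFamily

open scoped Matrix.Norms.L2Operator

/-- The quadratic map `fMap t` on symmetric matrices. -/
noncomputable def symFMap (t : ℝ) (Z : SymMat 2) : SymMat 4 :=
  ⟨fMap t Z.1, by
    have hZ := SymMat.apply_comm Z 1 0
    change (fMap t Z.1)ᵀ = fMap t Z.1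
    ext i j
    fin_cases i <;> fin_cases j <;> simp [fMap, hZ] ⟩

/-- The matrix `fMap t Z` in terms of `α = √(2 - t)`, `β = √(1 - t)`, `γ = √t`. -/
lemma symFMap_coe {t : ℝ} (h0 : 0 ≤ t) (h1 : t ≤ 1) :
    ∃ α β γ : ℝ, 0 < α ∧ 0 ≤ β ∧ 0 ≤ γ ∧ α ^ 2 = 1 + β ^ 2 ∧ β ^ 2 + γ ^ 2 = 1 ∧ γ = √t ∧
      ∀ Z : SymMat 2, (symFMap t Z).1 =
        !![Z.1 0 0 ^ 2, α * Z.1 0 0 * Z.1 0 1, β * Z.1 0 1 ^ 2, γ * Z.1 0 1;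
          α * Z.1 0 0 * Z.1 0 1, 2 * (β / α) ^ 2 * Z.1 0 0 * Z.1 1 1 + Z.1 0 1 ^ 2,
            2 * (β / α) * Z.1 0 1 * Z.1 1 1, γ / α * Z.1 1 1;
          β * Z.1 0 1 ^ 2, 2 * (β / α) * Z.1 0 1 * Z.1 1 1, Z.1 1 1 ^ 2, 0;
          γ * Z.1 0 1, γ / α * Z.1 1 1, 0, 0] := by
  have hα : √(2 - t) ^ 2 = 2 - t := Real.sq_sqrt (by linarith)
  have hβ : √(1 - t) ^ 2 = 1 - t := Real.sq_sqrt (by linarith)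
  have hγ : √t ^ 2 = t := Real.sq_sqrt h0
  refine ⟨√(2 - t), √(1 - t), √t, Real.sqrt_pos.2 (by linarith), Real.sqrt_nonneg _,
    Real.sqrt_nonneg _, by linarith, by linarith, rfl, fun Z => ?_⟩
  have e1 : 2 * (1 - t) / (2 - t) = 2 * (√(1 - t) / √(2 - t)) ^ 2 := by
    rw [div_pow, hα, hβ]; ring
  have e2 : √((1 - t) / (2 - t)) = √(1 - t) / √(2 - t) := Real.sqrt_div (by linarith) _
  have e3 : √(t / (2 - t)) = √t / √(2 - t) := Real.sqrt_div h0 _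
  have hZ := SymMat.apply_comm Z 1 0
  change fMap t Z.1 = _
  simp only [fMap, e1, e2, e3, hZ]
  push_cast
  ext i j
  fin_cases i <;> fin_cases j <;> simp <;> ring

lemma sqNorm_two (x : Fin 2 → ℂ) : sqNorm x = ‖x 0‖ ^ 2 + ‖x 1‖ ^ 2 := by
  simp [sqNorm, Fin.sum_univ_two]

lemma sqNorm_four (x : Fin 4 → ℂ) :
    sqNorm x = ‖x 0‖ ^ 2 + ‖x 1‖ ^ 2 + ‖x 2‖ ^ 2 + ‖x 3‖ ^ 2 := by
  simp [sqNorm, Fin.sum_univ_four]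

lemma norm_sq_add_le (a b x y : ℂ) :
    ‖a * x + b * y‖ ^ 2 ≤ (‖a‖ ^ 2 + ‖b‖ ^ 2) * (‖x‖ ^ 2 + ‖y‖ ^ 2) := by
  have h1 : ‖a * x + b * y‖ ≤ ‖a‖ * ‖x‖ + ‖b‖ * ‖y‖ := by
    simpa using norm_add_le (a * x) (b * y)
  have h2 := pow_le_pow_left₀ (norm_nonneg _) h1 2
  nlinarith [sq_nonneg (‖a‖ * ‖y‖ - ‖b‖ * ‖x‖)]

lemma sqNorm_mulVec_two_lt {Z : SymMat 2} (hZ : Z ∈ OmegaIII 2) {a b : ℂ}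
    (h : a ≠ 0 ∨ b ≠ 0) :
    ‖Z.1 0 0 * a + Z.1 0 1 * b‖ ^ 2 + ‖Z.1 0 1 * a + Z.1 1 1 * b‖ ^ 2 <
      ‖a‖ ^ 2 + ‖b‖ ^ 2 := by
  have := mem_OmegaIII_iff.1 hZ ![a, b] (by
    intro h0
    have e0 := congrFun h0 0
    have e1 := congrFun h0 1
    simp at e0 e1
    tauto)
  rw [sqNorm_two, sqNorm_two] at this
  simpa [Matrix.mulVec, dotProduct, Fin.sum_univ_two, SymMat.apply_comm Z 1 0] using this

lemma sqNorm_mulVec_two_le {Z : SymMat 2} (hZ : Z ∈ OmegaIII 2) (a b : ℂ) :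
    ‖Z.1 0 0 * a + Z.1 0 1 * b‖ ^ 2 + ‖Z.1 0 1 * a + Z.1 1 1 * b‖ ^ 2 ≤
      ‖a‖ ^ 2 + ‖b‖ ^ 2 := by
  by_cases h : a ≠ 0 ∨ b ≠ 0
  · exact (sqNorm_mulVec_two_lt hZ h).le
  · push Not at h
    simp [h.1, h.2]

/-- The matrix acts as a composition of contractions. An isometry spreads `(x1, x2, x3)` over two
vectors of `ℂ²`, using `1/α² + β²/α² = 1`; `Z` acts on each; a contraction governed by `β² + γ² = 1`
mixes in `x4` and splits off `γ Y21`; `Z` acts on two vectors again; a last contraction, the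
transpose of the spreading, recombines them. -/
lemma symFMap_mem {t : ℝ} (h0 : 0 ≤ t) (h1 : t ≤ 1) {Z : SymMat 2} (hZ : Z ∈ OmegaIII 2) :
    symFMap t Z ∈ OmegaIII 4 := by
  obtain ⟨α, β, γ, hα, hβ, hγ, hαβ, hβγ, -, hM⟩ := symFMap_coe h0 h1
  rw [mem_OmegaIII_iff]
  intro x hx
  have hα' : (α : ℂ) ≠ 0 := by exact_mod_cast hα.ne'
  have cαβ : (α : ℂ) ^ 2 = 1 + β ^ 2 := by exact_mod_cast hαβ
  have cβγ : (β : ℂ) ^ 2 + γ ^ 2 = 1 := by exact_mod_cast hβγ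
  have nβ : ‖(β : ℂ)‖ = β := by simp [abs_of_nonneg hβ]
  have nγ : ‖(γ : ℂ)‖ = γ := by simp [abs_of_nonneg hγ]
  have nα : ‖(α : ℂ)‖ = α := by simp [abs_of_pos hα]
  rw [sqNorm_four, sqNorm_four]
  set x1 := x 0 with hx1
  set x2 := x 1 with hx2
  set x3 := x 2 with hx3
  set x4 := x 3 with hx4
  set z1 := Z.1 0 0 with hz1
  set z2 := Z.1 0 1 with hz2
  set z3 := Z.1 1 1 with hz3
  obtain ⟨Y11, eY11⟩ : ∃ y, y = z1 * x1 + z2 * (x2 / α) := ⟨_, rfl⟩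
  obtain ⟨Y21, eY21⟩ : ∃ y, y = z2 * x1 + z3 * (x2 / α) := ⟨_, rfl⟩
  obtain ⟨Y12, eY12⟩ : ∃ y, y = z1 * (β * x2 / α) + z2 * x3 := ⟨_, rfl⟩
  obtain ⟨Y22, eY22⟩ : ∃ y, y = z2 * (β * x2 / α) + z3 * x3 := ⟨_, rfl⟩
  obtain ⟨w, ew⟩ : ∃ y, y = β * Y12 + γ * x4 := ⟨_, rfl⟩
  obtain ⟨O11, eO11⟩ : ∃ y, y = z1 * Y11 + z2 * w := ⟨_, rfl⟩
  obtain ⟨O21, eO21⟩ : ∃ y, y = z2 * Y11 + z3 * w := ⟨_, rfl⟩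
  obtain ⟨O12, eO12⟩ : ∃ y, y = z1 * (β * Y21) + z2 * Y22 := ⟨_, rfl⟩
  obtain ⟨O22, eO22⟩ : ∃ y, y = z2 * (β * Y21) + z3 * Y22 := ⟨_, rfl⟩
  have r0 : z1 ^ 2 * x1 + α * z1 * z2 * x2 + β * z2 ^ 2 * x3 + γ * z2 * x4 = O11 := by
    subst eO11 ew eY11 eY12
    field_simp
    linear_combination (z1 * z2 * x2) * cαβ
  have r1 : α * z1 * z2 * x1 + (2 * (β / α) ^ 2 * z1 * z3 + z2 ^ 2) * x2
      + 2 * (β / α) * z2 * z3 * x3 + γ / α * z3 * x4 = (α : ℂ)⁻¹ * O21 + β / α * O12 := by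
    subst eO21 eO12 ew eY11 eY12 eY21 eY22
    field_simp
    linear_combination (z2 ^ 2 * x2 + z1 * z2 * x1 * α) * cαβ
  have r2 : β * z2 ^ 2 * x1 + 2 * (β / α) * z2 * z3 * x2 + z3 ^ 2 * x3 = O22 := by
    subst eO22 eY21 eY22
    field_simp
    ring
  have r3 : γ * z2 * x1 + γ / α * z3 * x2 = γ * Y21 := by
    subst eY21
    field_simp
  have s1 := sqNorm_mulVec_two_le hZ x1 (x2 / α)
  have s1' := sqNorm_mulVec_two_le hZ (β * x2 / α) x3
  have s2 := norm_sq_add_le β γ Y12 x4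
  have s3 := sqNorm_mulVec_two_le hZ Y11 w
  have s3' := sqNorm_mulVec_two_le hZ (β * Y21) Y22
  have s4 := norm_sq_add_le ((α : ℂ)⁻¹) (β / α) O21 O12
  have ex : ‖x2 / α‖ ^ 2 + ‖β * x2 / α‖ ^ 2 = ‖x2‖ ^ 2 := by
    rw [norm_div, norm_div, norm_mul, nα, nβ]
    field_simp
    linear_combination -‖x2‖ ^ 2 * hαβ
  have ec : ‖(α : ℂ)⁻¹‖ ^ 2 + ‖(β : ℂ) / α‖ ^ 2 = 1 := by
    rw [norm_div, norm_inv, nα, nβ]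
    field_simp
    linarith
  rw [← eY11, ← eY21] at s1
  rw [← eY12, ← eY22] at s1'
  rw [← eO11, ← eO21] at s3
  rw [← eO12, ← eO22] at s3'
  rw [nβ, nγ, hβγ, one_mul, ← ew] at s2
  rw [ec, one_mul] at s4
  have eY : ‖β * Y21‖ ^ 2 + ‖γ * Y21‖ ^ 2 = ‖Y21‖ ^ 2 := by
    rw [norm_mul, norm_mul, nβ, nγ, mul_pow, mul_pow, ← add_mul, hβγ, one_mul]
  have key : ‖O11‖ ^ 2 + ‖(α : ℂ)⁻¹ * O21 + β / α * O12‖ ^ 2 + ‖O22‖ ^ 2 + ‖γ * Y21‖ ^ 2 <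
      ‖x1‖ ^ 2 + ‖x2‖ ^ 2 + ‖x3‖ ^ 2 + ‖x4‖ ^ 2 := by
    -- Strictness comes from the first use of `Z` unless only `x4` is nonzero. Then `w = γ x4`: if
    -- it is nonzero the second use of `Z` is strict, otherwise the contribution of `x4` is lost
    -- altogether.
    by_cases hX : x1 ≠ 0 ∨ x2 / α ≠ 0
    · have s := sqNorm_mulVec_two_lt hZ hX
      rw [← eY11, ← eY21] at s
      linarith
    by_cases hX' : β * x2 / α ≠ 0 ∨ x3 ≠ 0
    · have s := sqNorm_mulVec_two_lt hZ hX'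
      rw [← eY12, ← eY22] at s
      linarith
    push Not at hX hX'
    have hx2' : x2 = 0 := by simpa [hα'] using hX.2
    have hx4' : x4 ≠ 0 := by
      intro h4
      refine hx (funext fun i => ?_)
      fin_cases i
      exacts [hX.1, hx2', hX'.2, h4]
    have hY12 : Y12 = 0 := by rw [eY12, hX'.1, hX'.2]; simp
    by_cases hw : w = 0
    · have : 0 < ‖x4‖ ^ 2 := by positivity
      rw [hw] at s3
      simp only [norm_zero] at s3
      linarith [sq_nonneg ‖Y12‖]
    · have s := sqNorm_mulVec_two_lt hZ (Or.inr hw : Y11 ≠ 0 ∨ w ≠ 0)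
      rw [← eO11, ← eO21] at s
      linarith
  have e0 : ((symFMap t Z).1 *ᵥ x) 0 = O11 := by
    rw [hM, ← r0]
    simp [Matrix.mulVec, dotProduct, Fin.sum_univ_four, x1, x2, x3, x4, z1, z2]
  have e1 : ((symFMap t Z).1 *ᵥ x) 1 = (α : ℂ)⁻¹ * O21 + β / α * O12 := by
    rw [hM, ← r1]
    simp [Matrix.mulVec, dotProduct, Fin.sum_univ_four, x1, x2, x3, x4, z1, z2, z3]
  have e2 : ((symFMap t Z).1 *ᵥ x) 2 = O22 := by
    rw [hM, ← r2]
    simp [Matrix.mulVec, dotProduct, Fin.sum_univ_four, x1, x2, x3, z2, z3]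
  have e3 : ((symFMap t Z).1 *ᵥ x) 3 = γ * Y21 := by
    rw [hM, ← r3]
    simp [Matrix.mulVec, dotProduct, Fin.sum_univ_four, x1, x2, z2, z3]
  rw [e0, e1, e2, e3]
  exact key

lemma symFMap_boundary {t : ℝ} (h0 : 0 ≤ t) (h1 : t ≤ 1) {Z : SymMat 2} (hZ : ‖Z‖ = 1) :
    symFMap t Z ∉ OmegaIII 4 := by
  obtain ⟨α, β, γ, hα, hβ, hγ, hαβ, hβγ, -, hM⟩ := symFMap_coe h0 h1
  have hα' : (α : ℂ) ≠ 0 := by exact_mod_cast hα.ne'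
  have cαβ : (α : ℂ) ^ 2 = 1 + β ^ 2 := by exact_mod_cast hαβ
  have cβγ : (β : ℂ) ^ 2 + γ ^ 2 = 1 := by exact_mod_cast hβγ
  obtain ⟨v, hv, hZv⟩ := exists_mulVec_eq_star hZ
  have q0 := congrFun hZv 0
  have q1 := congrFun hZv 1
  simp only [Matrix.mulVec, dotProduct, Fin.sum_univ_two, SymMat.apply_comm Z 1 0,
    Pi.star_apply] at q0 q1
  obtain ⟨p, hp⟩ : ∃ p, p = star (v 0) := ⟨_, rfl⟩
  obtain ⟨q, hq⟩ : ∃ q, q = star (v 1) := ⟨_, rfl⟩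
  have np : ‖p‖ = ‖v 0‖ := by rw [hp, norm_star]
  have nq : ‖q‖ = ‖v 1‖ := by rw [hq, norm_star]
  rw [← hp] at q0
  rw [← hq] at q1
  -- The test vector of the main case could vanish here (when `β = 0`), so the third basis vector is
  -- used: now `Z` is diagonal with a unimodular lower entry.
  by_cases hv0 : v 0 = 0
  · have hv1 : v 1 ≠ 0 := fun h => hv (funext fun i => by fin_cases i; exacts [hv0, h])
    have hz2 : Z.1 0 1 = 0 := by
      rw [hp, hv0] at q0; simpa [hv1] using q0
    have hz3 : ‖Z.1 1 1‖ = 1 := by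
      rw [hv0, mul_zero, zero_add] at q1
      have := congrArg norm q1
      rw [norm_mul, nq] at this
      exact (mul_eq_right₀ (norm_ne_zero_iff.2 hv1)).1 this
    refine notMem_OmegaIII_of_le (x := Pi.single 2 1) (by simp) ?_
    rw [hM, sqNorm_four, sqNorm_four]
    simp [hz2, hz3]
  · have hx0 : ![v 0 ^ 2, α * v 0 * v 1, β * v 1 ^ 2, γ * p * v 1] ≠ 0 := by
      intro h
      simpa [hv0] using congrFun h 0
    refine notMem_OmegaIII_of_le hx0 ?_
    rw [sqNorm_four, sqNorm_four]
    set z1 := Z.1 0 0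
    set z2 := Z.1 0 1
    set z3 := Z.1 1 1
    have r0 : z1 ^ 2 * v 0 ^ 2 + α * z1 * z2 * (α * v 0 * v 1) + β * z2 ^ 2 * (β * v 1 ^ 2)
        + γ * z2 * (γ * p * v 1) = p ^ 2 := by
      subst q0
      linear_combination (z1 * z2 * v 0 * v 1) * cαβ +
        (z2 * v 1 * (z1 * v 0 + z2 * v 1)) * cβγ
    have r1 : α * z1 * z2 * v 0 ^ 2 + (2 * (β / α) ^ 2 * z1 * z3 + z2 ^ 2) * (α * v 0 * v 1)
        + 2 * (β / α) * z2 * z3 * (β * v 1 ^ 2) + γ / α * z3 * (γ * p * v 1) = α * (p * q) := by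
      subst q0 q1
      field_simp
      linear_combination (z1 * z2 * v 0 ^ 2 + z2 ^ 2 * v 0 * v 1 -
          (z1 * v 0 + z2 * v 1) * (z2 * v 0 + z3 * v 1)) * cαβ +
        (z3 * v 1 * (z1 * v 0 + z2 * v 1)) * cβγ
    have r2 : β * z2 ^ 2 * v 0 ^ 2 + 2 * (β / α) * z2 * z3 * (α * v 0 * v 1)
        + z3 ^ 2 * (β * v 1 ^ 2) = β * q ^ 2 := by
      subst q1
      field_simp
      ring
    have r3 : γ * z2 * v 0 ^ 2 + γ / α * z3 * (α * v 0 * v 1) = γ * (q * v 0) := by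
      subst q1
      field_simp
    have key : ‖v 0 ^ 2‖ ^ 2 + ‖α * v 0 * v 1‖ ^ 2 + ‖β * v 1 ^ 2‖ ^ 2 + ‖γ * p * v 1‖ ^ 2 ≤
        ‖p ^ 2‖ ^ 2 + ‖α * (p * q)‖ ^ 2 + ‖β * q ^ 2‖ ^ 2 + ‖γ * (q * v 0)‖ ^ 2 := by
      simp only [norm_mul, norm_pow, np, nq]
      exact le_of_eq (by ring)
    have e0 : ((symFMap t Z).1 *ᵥ ![v 0 ^ 2, α * v 0 * v 1, β * v 1 ^ 2, γ * p * v 1]) 0 =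
        p ^ 2 := by
      rw [hM, ← r0]
      simp [Matrix.mulVec, dotProduct, Fin.sum_univ_four, z1, z2]
    have e1 : ((symFMap t Z).1 *ᵥ ![v 0 ^ 2, α * v 0 * v 1, β * v 1 ^ 2, γ * p * v 1]) 1 =
        α * (p * q) := by
      rw [hM, ← r1]
      simp [Matrix.mulVec, dotProduct, Fin.sum_univ_four, z1, z2, z3]
    have e2 : ((symFMap t Z).1 *ᵥ ![v 0 ^ 2, α * v 0 * v 1, β * v 1 ^ 2, γ * p * v 1]) 2 =
        β * q ^ 2 := by
      rw [hM, ← r2]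
      simp [Matrix.mulVec, dotProduct, Fin.sum_univ_four, z2, z3]
    have e3 : ((symFMap t Z).1 *ᵥ ![v 0 ^ 2, α * v 0 * v 1, β * v 1 ^ 2, γ * p * v 1]) 3 =
        γ * (q * v 0) := by
      rw [hM, ← r3]
      simp [Matrix.mulVec, dotProduct, Fin.sum_univ_four, z2, z3]
    rw [e0, e1, e2, e3]
    exact key

lemma differentiable_symFMap (t : ℝ) : Differentiable ℂ (symFMap t) := by
  rw [← differentiableOn_univ]
  refine differentiableOn_of_entry fun i j => Differentiable.differentiableOn ?_
  have e : ∀ Z : SymMat 2, (symFMap t Z).1 = fMap t Z.1 := fun _ => rfl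
  simp only [e, fMap]
  fin_cases i <;> fin_cases j <;> simp <;> simp only [← entryCLM_apply] <;> fun_prop

end QuadraticFamily

/-! ### Critical points and derivatives of the explicit family -/

section QuadraticFamilyDerivative

open scoped Matrix.Norms.L2Operator

/-- The central difference is exact because the entries are polynomials of degree at most two; `q`
below is the corresponding second-order coefficient. -/
lemma fderiv_symFMap {t : ℝ} (h0 : 0 ≤ t) (h1 : t ≤ 1) (Z H : SymMat 2) :
    fderiv ℂ (symFMap t) Z H = (1 / 2 : ℂ) • (symFMap t (Z + H) - symFMap t (Z - H)) := by
  obtain ⟨α, β, γ, hα, hβ, hγ, hαβ, hβγ, -, hM⟩ := symFMap_coe h0 h1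
  refine fderiv_apply_of_quadratic
    (q := (1 / 2 : ℂ) • (symFMap t (Z + H) + symFMap t (Z - H)) - symFMap t Z)
    (differentiable_symFMap t Z) fun c => ?_
  refine SymMat.ext_entry fun i j => ?_
  simp only [Submodule.coe_add, Submodule.coe_sub, Submodule.coe_smul, hM]
  fin_cases i <;> fin_cases j <;> simp <;> ring

/-- The symmetric matrix `diag(a, b)`. -/
def symDiag (a b : ℂ) : SymMat 2 :=
  ⟨!![a, 0; 0, b], by
    change !![a, 0; 0, b]ᵀ = !![a, 0; 0, b]
    ext i j; fin_cases i <;> fin_cases j <;> rfl⟩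

lemma symFMap_zero (t : ℝ) : symFMap t 0 = 0 := by
  refine SymMat.ext_entry fun i j => ?_
  change fMap t 0 i j = 0
  fin_cases i <;> fin_cases j <;> simp [fMap]

/-- The variable `z₁` enters only through `z₁²`, `z₁ z₂` and `z₁ z₄`. The first two have no
first-order change in direction `diag(1, 0)` at `diag(0, b)`; the third has coefficient zero when `t
= 1` and no first-order change when `b = 0`. -/
lemma fderiv_symFMap_not_injective {t : ℝ} (h0 : 0 ≤ t) (h1 : t ≤ 1) {b : ℂ}
    (hb : t = 1 ∨ b = 0) : ¬ Function.Injective (fderiv ℂ (symFMap t) (symDiag 0 b)) := by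
  intro hinj
  have hz : fderiv ℂ (symFMap t) (symDiag 0 b) (symDiag 1 0) = 0 := by
    rw [fderiv_symFMap h0 h1]
    refine SymMat.ext_entry fun i j => ?_
    change (1 / 2 : ℂ) * (fMap t ((symDiag 0 b).1 + (symDiag 1 0).1) i j -
      fMap t ((symDiag 0 b).1 - (symDiag 1 0).1) i j) = 0
    rcases hb with rfl | rfl <;>
    fin_cases i <;> fin_cases j <;> simp [fMap, symDiag]
  have h := hinj (hz.trans (map_zero _).symm)
  have := congrArg (fun Z : SymMat 2 => Z.1 0 0) h
  simp [symDiag] at this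

/-- For `t < 1` the number `β` is nonzero, and the entries outside the last row and column say that
the product of the linear forms with coefficients `(z1, z2, z3)` and `(k1, k2, k3)` is zero. A
polynomial ring over `ℂ` has no zero divisors. -/
lemma fderiv_symFMap_injective_iff {t : ℝ} (h0 : 0 ≤ t) (h1 : t < 1) (Z : SymMat 2) :
    Function.Injective (fderiv ℂ (symFMap t) Z) ↔ Z ≠ 0 := by
  constructor
  · rintro hinj rfl
    refine fderiv_symFMap_not_injective h0 h1.le (b := 0) (Or.inr rfl) ?_
    convert! hinj using 3
    refine SymMat.ext_entry fun i j => ?_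
    fin_cases i <;> fin_cases j <;> rfl
  · intro hZ
    obtain ⟨α, β, γ, hα, hβ, hγ, hαβ, hβγ, hγt, hM⟩ := symFMap_coe h0 h1.le
    have hγ1 : γ < 1 := by rw [hγt, Real.sqrt_lt' one_pos]; simpa using h1
    have hβ' : β ≠ 0 := by
      rintro rfl
      nlinarith
    have cα : (α : ℂ) ≠ 0 := by exact_mod_cast hα.ne'
    have cβ : (β : ℂ) ≠ 0 := by exact_mod_cast hβ'
    rw [injective_iff_map_eq_zero]
    intro H hH
    rw [fderiv_symFMap h0 h1.le] at hH
    have hE : ∀ i j, (symFMap t (Z + H)).1 i j - (symFMap t (Z - H)).1 i j = 0 := by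
      intro i j
      have := congrArg (fun W : SymMat 4 => W.1 i j) hH
      simpa using this
    simp only [hM, Submodule.coe_add, Submodule.coe_sub] at hE
    have e00 := hE 0 0
    have e01 := hE 0 1
    have e02 := hE 0 2
    have e11 := hE 1 1
    have e12 := hE 1 2
    have e22 := hE 2 2
    simp at e00 e01 e02 e11 e12 e22
    clear hE hH
    have hZ' : ¬ (Z.1 0 0 = 0 ∧ Z.1 0 1 = 0 ∧ Z.1 1 1 = 0) := by
      rintro ⟨a, b, c⟩
      refine hZ (SymMat.ext_entry fun i j => ?_)
      fin_cases i <;> fin_cases j <;> simp [a, b, c, SymMat.apply_comm Z 1 0]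
    have hH' : H.1 0 0 = 0 ∧ H.1 0 1 = 0 ∧ H.1 1 1 = 0 → H = 0 := by
      rintro ⟨a, b, c⟩
      refine SymMat.ext_entry fun i j => ?_
      fin_cases i <;> fin_cases j <;> simp [a, b, c, SymMat.apply_comm H 1 0]
    apply hH'
    generalize Z.1 0 0 = z1 at *
    generalize Z.1 0 1 = z2 at *
    generalize Z.1 1 1 = z3 at *
    generalize H.1 0 0 = k1 at *
    generalize H.1 0 1 = k2 at *
    generalize H.1 1 1 = k3 at *
    have f1 : z1 * k1 = 0 := by linear_combination e00 / 4
    have f2 : z2 * k2 = 0 := mul_left_cancel₀ cβ (by linear_combination e02 / 4)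
    have f3 : z3 * k3 = 0 := by linear_combination e22 / 4
    have f4 : z1 * k2 + z2 * k1 = 0 := mul_left_cancel₀ cα (by linear_combination e01 / 2)
    have f5 : z1 * k3 + z3 * k1 = 0 := by
      refine mul_left_cancel₀ (pow_ne_zero 2 (div_ne_zero cβ cα)) ?_
      linear_combination e11 / 4 - f2
    have f6 : z2 * k3 + z3 * k2 = 0 :=
      mul_left_cancel₀ (div_ne_zero cβ cα) (by linear_combination e12 / 4)
    by_cases a : z1 = 0
    · by_cases b : z2 = 0
      · have c : z3 ≠ 0 := fun c => hZ' ⟨a, b, c⟩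
        subst a b
        simp_all
      · subst a
        simp_all
    · simp_all

/-- Only the last row and column have linear terms, `γ z₂` and `(γ/α) z₃` with `α ≥ 1`; their length
is at most `γ` times that of the second column of `H`. The exchange matrix attains the bound. -/
lemma norm_fderiv_symFMap {t : ℝ} (h0 : 0 ≤ t) (h1 : t ≤ 1) :
    ‖fderiv ℂ (symFMap t) 0‖ = √t := by
  obtain ⟨α, β, γ, hα, hβ, hγ, hαβ, hβγ, hγt, hM⟩ := symFMap_coe h0 h1
  rw [← hγt]
  have hD : ∀ H : SymMat 2, (fderiv ℂ (symFMap t) 0 H).1 =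
      !![0, 0, 0, γ * H.1 0 1; 0, 0, 0, γ / α * H.1 1 1; 0, 0, 0, 0;
        γ * H.1 0 1, γ / α * H.1 1 1, 0, 0] := by
    intro H
    rw [fderiv_symFMap h0 h1]
    simp only [Submodule.coe_add, Submodule.coe_sub, Submodule.coe_smul, hM]
    ext i j
    fin_cases i <;> fin_cases j <;> simp <;> ring
  have nγ : ‖(γ : ℂ)‖ = γ := by simp [abs_of_nonneg hγ]
  have nα : ‖(α : ℂ)‖ = α := by simp [abs_of_pos hα]
  refine le_antisymm (ContinuousLinearMap.opNorm_le_bound _ hγ fun H => ?_) ?_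
  · refine norm_le_of_sqNorm_mulVec_le _ (by positivity) fun x => ?_
    have h2 : ‖H.1 0 1‖ ^ 2 + ‖H.1 1 1‖ ^ 2 ≤ ‖H‖ ^ 2 := by
      have := norm_mulVec_le H.1 (Pi.single 1 1)
      simpa [sqNorm_two] using this
    have h3 : ‖γ * H.1 0 1‖ ^ 2 + ‖γ / α * H.1 1 1‖ ^ 2 ≤ (γ * ‖H‖) ^ 2 := by
      have h4 : (γ / α) ^ 2 ≤ γ ^ 2 := by
        have : γ / α ≤ γ := div_le_self hγ (by nlinarith)
        exact pow_le_pow_left₀ (by positivity) this 2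
      rw [norm_mul, norm_mul, norm_div, nγ, nα, mul_pow, mul_pow, mul_pow]
      nlinarith [sq_nonneg ‖H.1 1 1‖, mul_le_mul_of_nonneg_left h2 (sq_nonneg γ),
        mul_le_mul_of_nonneg_right h4 (sq_nonneg ‖H.1 1 1‖)]
    rw [hD, sqNorm_four, sqNorm_four]
    generalize (γ : ℂ) * H.1 0 1 = p at *
    generalize (γ : ℂ) / α * H.1 1 1 = q at *
    generalize (γ * ‖H‖) ^ 2 = N at *
    have hN : 0 ≤ N := le_trans (by positivity) h3
    have h5 := norm_sq_add_le p q (x 0) (x 1)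
    have h6 := mul_le_mul_of_nonneg_right h3 (sq_nonneg ‖x 3‖)
    have h7 := mul_le_mul_of_nonneg_right h3 (add_nonneg (sq_nonneg ‖x 0‖) (sq_nonneg ‖x 1‖))
    have h8 := mul_nonneg hN (sq_nonneg ‖x 2‖)
    simp only [Matrix.mulVec, dotProduct, Fin.sum_univ_four, Matrix.of_apply, Matrix.cons_val,
      zero_mul, zero_add, add_zero, norm_zero, norm_mul, mul_pow]
    linarith
  · let H : SymMat 2 := ⟨!![0, 1; 1, 0], by
      change !![(0 : ℂ), 1; 1, 0]ᵀ = !![0, 1; 1, 0]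
      ext i j; fin_cases i <;> fin_cases j <;> rfl⟩
    have hH : ‖H‖ ≤ 1 := by
      refine norm_le_of_sqNorm_mulVec_le _ zero_le_one fun x => ?_
      simp [sqNorm_two, H, dotProduct, add_comm]
    refine le_trans ?_ (ContinuousLinearMap.unit_le_opNorm _ H hH)
    refine le_norm_of_le_sqNorm_mulVec _ (x := Pi.single 3 1) (by simp) ?_
    rw [hD, sqNorm_four, sqNorm_four]
    simp [H]

/-- The family of proper maps given by `fMap`. -/
noncomputable def fMapOmega (t : Set.Icc (0 : ℝ) 1) (Z : OmegaIII 2) : OmegaIII 4 :=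
  ⟨symFMap t Z, symFMap_mem t.2.1 t.2.2 Z.2⟩

lemma fMapOmega_isHolomorphicMap (t : Set.Icc (0 : ℝ) 1) : IsHolomorphicMap (fMapOmega t) :=
  ⟨symFMap t, (differentiable_symFMap t).differentiableOn, fun _ => rfl⟩

lemma fMapOmega_isProperBetween (t : Set.Icc (0 : ℝ) 1) : IsProperBetween (fMapOmega t) :=
  isProperBetween_of_boundary (symFMap t) (differentiable_symFMap t).continuous.continuousOn
    (fun _ hZ => symFMap_boundary t.2.1 t.2.2 hZ) fun _ => rfl

lemma fMapOmega_not_holEquivalent_one {s t : Set.Icc (0 : ℝ) 1} (hs : (s : ℝ) = 1)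
    (ht : (t : ℝ) < 1) : ¬ HolEquivalent (fMapOmega s) (fMapOmega t) := by
  have hz : symDiag 0 0 = 0 := by
    refine SymMat.ext_entry fun i j => ?_
    fin_cases i <;> fin_cases j <;> rfl
  -- For `t = 1` every `diag(0, b)` is critical; `b = 1/2` is a nonzero choice inside the domain.
  refine not_holEquivalent_of_critical (F := symFMap s) (G := symFMap t)
    (p := symDiag 0 (1 / 2)) (fun _ => rfl)
    (fun _ => rfl) (differentiable_symFMap t).differentiableOn ?_ ?_ ?_ ?_
    (fderiv_symFMap_injective_iff t.2.1 ht)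
  · rw [← hz]
    exact fderiv_symFMap_not_injective s.2.1 s.2.2 (Or.inr rfl)
  · rw [mem_OmegaIII_iff_norm]
    refine lt_of_le_of_lt (norm_le_of_sqNorm_mulVec_le _ (r := 1 / 2) (by norm_num) fun x => ?_)
      (by norm_num)
    simp [sqNorm_two, symDiag, dotProduct, mul_pow]
  · intro h
    have := congrArg (fun Z : SymMat 2 => Z.1 1 1) h
    simp [symDiag] at this
  · exact fderiv_symFMap_not_injective s.2.1 s.2.2 (Or.inl hs)

lemma fMapOmega_not_holEquivalent {s t : Set.Icc (0 : ℝ) 1} (hst : s ≠ t) :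
    ¬ HolEquivalent (fMapOmega s) (fMapOmega t) := by
  rcases s.2.2.lt_or_eq with hs | hs <;> rcases t.2.2.lt_or_eq with ht | ht
  · intro h
    have := h.norm_fderiv_eq (F := symFMap s) (G := symFMap t) (fun _ => rfl) (fun _ => rfl)
      (differentiable_symFMap s).differentiableOn (differentiable_symFMap t).differentiableOn
      (symFMap_zero _) (symFMap_zero _) (fderiv_symFMap_injective_iff s.2.1 hs)
      (fderiv_symFMap_injective_iff t.2.1 ht)
    rw [norm_fderiv_symFMap s.2.1 s.2.2, norm_fderiv_symFMap t.2.1 t.2.2,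
      Real.sqrt_inj s.2.1 t.2.1] at this
    exact hst (Subtype.ext this)
  · exact fun h => fMapOmega_not_holEquivalent_one ht hs h.symm
  · exact fMapOmega_not_holEquivalent_one hs ht
  · exact absurd (Subtype.ext (hs.trans ht.symm)) hst

end QuadraticFamilyDerivative

/-! ### The symmetric square of a matrix -/

section SymmetricSquare

open scoped Matrix.Norms.L2Operator Kronecker

/-- The matrix of the orthogonal projection of `ℂⁿ ⊗ ℂⁿ` onto its symmetric tensors, in an
orthonormal basis indexed by unordered pairs. -/
noncomputable def symTensor (n : ℕ) : Matrix (Sym2 (Fin n)) (Fin n × Fin n) ℂ :=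
  fun s p => if s = s(p.1, p.2) then
    (((Real.sqrt (Finset.univ.filter fun q : Fin n × Fin n => s = s(q.1, q.2)).card)⁻¹ : ℝ) : ℂ)
  else 0

variable {n : ℕ}

/-- Rows have disjoint supports, the fibres of ordered over unordered pairs, and each is normalised
by the square root of its fibre size. -/
lemma symTensor_mul_transpose : symTensor n * (symTensor n)ᵀ = 1 := by
  ext s s'
  rw [Matrix.mul_apply, Matrix.one_apply]
  split_ifs with h
  · subst h
    have hne : (Finset.univ.filter fun q : Fin n × Fin n => s = s(q.1, q.2)).card ≠ 0 := by
      rw [Finset.card_ne_zero]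
      induction s with
      | _ i j => exact ⟨(i, j), by simp⟩
    simp only [symTensor, Matrix.transpose_apply, ← ite_and, mul_ite, mul_zero, ite_mul, zero_mul,
      and_self]
    rw [← Finset.sum_filter, Finset.sum_const, nsmul_eq_mul, ← Complex.ofReal_mul, ← mul_inv,
      Real.mul_self_sqrt (by positivity)]
    push_cast
    rw [mul_inv_cancel₀ (by exact_mod_cast hne)]
  · refine Finset.sum_eq_zero fun p _ => ?_
    simp only [symTensor, Matrix.transpose_apply]
    split_ifs with h1 h2
    · exact absurd (h1.trans h2.symm) h
    all_goals simp

/-- A symmetric tensor is constant on the fibres over unordered pairs, so averaging over a fibre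
leaves it unchanged. -/
lemma transpose_mul_symTensor_mulVec {X : Fin n × Fin n → ℂ} (hX : ∀ i j, X (i, j) = X (j, i)) :
    (symTensor n)ᵀ *ᵥ (symTensor n *ᵥ X) = X := by
  have hfib : ∀ p q : Fin n × Fin n, s(p.1, p.2) = s(q.1, q.2) → X q = X p := by
    rintro ⟨i, j⟩ ⟨k, l⟩ h
    rcases Sym2.eq_iff.1 h with ⟨h1, h2⟩ | ⟨h1, h2⟩
    · simp only at h1 h2; rw [h1, h2]
    · simp only at h1 h2; rw [h1, h2, hX]
  ext p
  have h1 := congrFun (congrFun (symTensor_mul_transpose (n := n)) s(p.1, p.2)) s(p.1, p.2)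
  rw [Matrix.mul_apply, Matrix.one_apply_eq] at h1
  have e1 : ((symTensor n)ᵀ *ᵥ (symTensor n *ᵥ X)) p =
      symTensor n s(p.1, p.2) p * (symTensor n *ᵥ X) s(p.1, p.2) := by
    rw [Matrix.mulVec, dotProduct, Finset.sum_eq_single s(p.1, p.2)]
    · rfl
    · intro s _ hs
      simp [Matrix.transpose_apply, symTensor, hs]
    · simp
  have e2 : symTensor n s(p.1, p.2) p * (symTensor n *ᵥ X) s(p.1, p.2) =
      (∑ q, symTensor n s(p.1, p.2) q * (symTensor n)ᵀ q s(p.1, p.2)) * X p := by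
    rw [Matrix.mulVec, dotProduct, Finset.mul_sum, Finset.sum_mul]
    refine Finset.sum_congr rfl fun q _ => ?_
    by_cases hq : s(p.1, p.2) = s(q.1, q.2)
    · rw [hfib p q hq]
      simp [symTensor, Matrix.transpose_apply, hq]
      ring
    · simp [symTensor, hq]
  rw [e1, e2, h1, one_mul]

lemma star_symTensor_mulVec (X : Fin n × Fin n → ℂ) :
    symTensor n *ᵥ star X = star (symTensor n *ᵥ X) := by
  ext s
  simp only [Matrix.mulVec, dotProduct, Pi.star_apply, star_sum, star_mul']
  refine Finset.sum_congr rfl fun p _ => ?_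
  congr 1
  simp only [symTensor]
  split_ifs <;> simp

lemma symTensor_conjTranspose : (symTensor n)ᴴ = (symTensor n)ᵀ := by
  ext p s
  simp only [symTensor, Matrix.conjTranspose_apply, Matrix.transpose_apply]
  split_ifs <;> simp

lemma sqNorm_symTensor_transpose_mulVec (x : Sym2 (Fin n) → ℂ) :
    sqNorm ((symTensor n)ᵀ *ᵥ x) = sqNorm x := by
  apply Complex.ofReal_injective
  rw [← star_dotProduct_self, ← star_dotProduct_self, Matrix.star_mulVec,
    ← symTensor_conjTranspose, Matrix.conjTranspose_conjTranspose, symTensor_conjTranspose,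
    ← Matrix.dotProduct_mulVec, Matrix.mulVec_mulVec, symTensor_mul_transpose, Matrix.one_mulVec]

/-- The adjoint is an isometry, so its norm, which is also that of `symTensor n`, is at most one. -/
lemma sqNorm_symTensor_mulVec_le (X : Fin n × Fin n → ℂ) :
    sqNorm (symTensor n *ᵥ X) ≤ sqNorm X := by
  refine (norm_mulVec_le _ _).trans ?_
  have h1 : ‖(symTensor n)ᵀ‖ ≤ 1 := by
    rw [Matrix.l2_opNorm_def]
    refine ContinuousLinearMap.opNorm_le_bound _ zero_le_one fun x => ?_
    have := sqNorm_symTensor_transpose_mulVec x.ofLp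
    rw [sqNorm_eq, sqNorm_eq] at this
    rw [one_mul]
    exact (sq_le_sq₀ (norm_nonneg _) (norm_nonneg _)).1 this.le
  rw [← symTensor_conjTranspose, Matrix.l2_opNorm_conjTranspose] at h1
  have h2 : ‖symTensor n‖ ^ 2 ≤ 1 := pow_le_one₀ (norm_nonneg _) h1
  nlinarith [sqNorm_nonneg X]

lemma kronecker_mulVec_apply (Z W : Matrix (Fin n) (Fin n) ℂ) (X : Fin n × Fin n → ℂ)
    (i j : Fin n) :
    ((Z ⊗ₖ W) *ᵥ X) (i, j) = (Z *ᵥ fun k => (W *ᵥ fun l => X (k, l)) j) i := by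
  simp only [Matrix.mulVec, dotProduct, Fintype.sum_prod_type, Matrix.kroneckerMap_apply,
    Finset.mul_sum, mul_assoc]

lemma sqNorm_prod (X : Fin n × Fin n → ℂ) : sqNorm X = ∑ i, sqNorm fun j => X (i, j) := by
  simp only [sqNorm, Fintype.sum_prod_type]

lemma sqNorm_prod_right (X : Fin n × Fin n → ℂ) : sqNorm X = ∑ j, sqNorm fun i => X (i, j) := by
  simp only [sqNorm, Fintype.sum_prod_type_right]

/-- `Z` acts on one tensor index at a time; acting on the second index already strictly shortens
some nonzero slice of `X`. -/
lemma sqNorm_kronecker_mulVec_lt {Z : SymMat n} (hZ : Z ∈ OmegaIII n) {X : Fin n × Fin n → ℂ}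
    (hX : X ≠ 0) : sqNorm ((Z.1 ⊗ₖ Z.1) *ᵥ X) < sqNorm X := by
  have hle : ∀ x, sqNorm (Z.1 *ᵥ x) ≤ sqNorm x := by
    intro x
    by_cases hx : x = 0
    · simp [hx]
    · exact (mem_OmegaIII_iff.1 hZ x hx).le
  calc sqNorm ((Z.1 ⊗ₖ Z.1) *ᵥ X)
      = ∑ j, sqNorm (Z.1 *ᵥ fun k => (Z.1 *ᵥ fun l => X (k, l)) j) := by
        rw [sqNorm_prod_right]
        simp only [kronecker_mulVec_apply]
    _ ≤ ∑ j, sqNorm fun k => (Z.1 *ᵥ fun l => X (k, l)) j := Finset.sum_le_sum fun j _ => hle _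
    _ = ∑ k, sqNorm (Z.1 *ᵥ fun l => X (k, l)) := by
        simp only [sqNorm]; exact Finset.sum_comm
    _ < ∑ k, sqNorm fun l => X (k, l) := by
        obtain ⟨⟨i, j⟩, hij⟩ := Function.ne_iff.1 hX
        refine Finset.sum_lt_sum (fun k _ => hle _) ⟨i, Finset.mem_univ _, ?_⟩
        exact mem_OmegaIII_iff.1 hZ _ fun h => hij (congrFun h j)
    _ = sqNorm X := (sqNorm_prod X).symm

/-- The polarization of the symmetric square of a matrix. -/
noncomputable def symBil (Z W : Matrix (Fin n) (Fin n) ℂ) :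
    Matrix (Sym2 (Fin n)) (Sym2 (Fin n)) ℂ :=
  symTensor n * (Z ⊗ₖ W) * (symTensor n)ᵀ

lemma symBil_add_left (Z Z' W : Matrix (Fin n) (Fin n) ℂ) :
    symBil (Z + Z') W = symBil Z W + symBil Z' W := by
  simp only [symBil, Matrix.add_kronecker, Matrix.mul_add, Matrix.add_mul]

lemma symBil_add_right (Z W W' : Matrix (Fin n) (Fin n) ℂ) :
    symBil Z (W + W') = symBil Z W + symBil Z W' := by
  simp only [symBil, Matrix.kronecker_add, Matrix.mul_add, Matrix.add_mul]

lemma symBil_smul_left (c : ℂ) (Z W : Matrix (Fin n) (Fin n) ℂ) :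
    symBil (c • Z) W = c • symBil Z W := by
  simp only [symBil, Matrix.smul_kronecker, Matrix.mul_smul, Matrix.smul_mul]

lemma symBil_smul_right (c : ℂ) (Z W : Matrix (Fin n) (Fin n) ℂ) :
    symBil Z (c • W) = c • symBil Z W := by
  simp only [symBil, Matrix.kronecker_smul, Matrix.mul_smul, Matrix.smul_mul]

lemma symBil_neg_left (Z W : Matrix (Fin n) (Fin n) ℂ) : symBil (-Z) W = -symBil Z W := by
  simpa using symBil_smul_left (-1) Z W

lemma symBil_neg_right (Z W : Matrix (Fin n) (Fin n) ℂ) : symBil Z (-W) = -symBil Z W := by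
  simpa using symBil_smul_right (-1) Z W

lemma symBil_mulVec (Z W : Matrix (Fin n) (Fin n) ℂ) (x : Sym2 (Fin n) → ℂ) :
    symBil Z W *ᵥ x = symTensor n *ᵥ ((Z ⊗ₖ W) *ᵥ ((symTensor n)ᵀ *ᵥ x)) := by
  simp only [symBil, Matrix.mulVec_mulVec, Matrix.mul_assoc]

lemma sqNorm_symBil_mulVec_lt {Z : SymMat n} (hZ : Z ∈ OmegaIII n) {x : Sym2 (Fin n) → ℂ}
    (hx : x ≠ 0) : sqNorm (symBil Z.1 Z.1 *ᵥ x) < sqNorm x := by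
  rw [symBil_mulVec, ← sqNorm_symTensor_transpose_mulVec x]
  refine (sqNorm_symTensor_mulVec_le _).trans_lt (sqNorm_kronecker_mulVec_lt hZ fun h => hx ?_)
  rw [← sqNorm_eq_zero, ← sqNorm_symTensor_transpose_mulVec, h, sqNorm_eq_zero]

/-- The symmetric tensor square of a vector. -/
noncomputable def symVec (v : Fin n → ℂ) : Sym2 (Fin n) → ℂ :=
  symTensor n *ᵥ fun p => v p.1 * v p.2

lemma transpose_mulVec_symVec (v : Fin n → ℂ) :
    (symTensor n)ᵀ *ᵥ symVec v = fun p => v p.1 * v p.2 :=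
  transpose_mul_symTensor_mulVec fun _ _ => mul_comm _ _

lemma kronecker_mulVec_mul (Z W : Matrix (Fin n) (Fin n) ℂ) (v : Fin n → ℂ) :
    ((Z ⊗ₖ W) *ᵥ fun p => v p.1 * v p.2) = fun p => (Z *ᵥ v) p.1 * (W *ᵥ v) p.2 := by
  ext ⟨i, j⟩
  rw [kronecker_mulVec_apply]
  simp only [Matrix.mulVec, dotProduct, Finset.mul_sum, Finset.sum_mul]
  rw [Finset.sum_comm]
  refine Finset.sum_congr rfl fun k _ => Finset.sum_congr rfl fun l _ => by ring

lemma symVec_ne_zero {v : Fin n → ℂ} (hv : v ≠ 0) : symVec v ≠ 0 := by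
  intro h
  have := transpose_mulVec_symVec v
  rw [h, Matrix.mulVec_zero] at this
  refine hv (funext fun i => ?_)
  have h2 := congrFun this (i, i)
  simpa using h2.symm

lemma sqNorm_symBil_symVec {Z : Matrix (Fin n) (Fin n) ℂ} {v : Fin n → ℂ}
    (h : Z *ᵥ v = star v) : sqNorm (symBil Z Z *ᵥ symVec v) = sqNorm (symVec v) := by
  rw [symBil_mulVec, transpose_mulVec_symVec, kronecker_mulVec_mul, h]
  have : (fun p : Fin n × Fin n => (star v) p.1 * (star v) p.2) =
      star fun p : Fin n × Fin n => v p.1 * v p.2 := by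
    ext p; simp
  rw [this, star_symTensor_mulVec, sqNorm_star, symVec]

/-- Evaluated on `v ⊗ v`, the hypothesis says that the symmetric product of `Z v` and `H v` is zero,
so `H v = 0` whenever `Z v ≠ 0`. Vectors outside the kernel of `Z` span the space. -/
lemma eq_zero_of_symBil_add_eq_zero {Z H : Matrix (Fin n) (Fin n) ℂ} (hZ : Z ≠ 0)
    (h : symBil Z H + symBil H Z = 0) : H = 0 := by
  have key : ∀ (v : Fin n → ℂ) i j,
      (Z *ᵥ v) i * (H *ᵥ v) j + (H *ᵥ v) i * (Z *ᵥ v) j = 0 := by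
    intro v i j
    have h1 := congrArg (fun M => M *ᵥ symVec v) h
    simp only [Matrix.add_mulVec, symBil_mulVec, transpose_mulVec_symVec, kronecker_mulVec_mul,
      Matrix.zero_mulVec, ← Matrix.mulVec_add] at h1
    have h2 := transpose_mul_symTensor_mulVec
      (X := (fun p : Fin n × Fin n => (Z *ᵥ v) p.1 * (H *ᵥ v) p.2) +
        fun p => (H *ᵥ v) p.1 * (Z *ᵥ v) p.2) (fun i j => by simp only [Pi.add_apply]; ring)
    rw [h1, Matrix.mulVec_zero] at h2
    exact (congrFun h2 (i, j)).symm
  have hker : ∀ v, Z *ᵥ v ≠ 0 → H *ᵥ v = 0 := by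
    intro v hv
    obtain ⟨i, hi⟩ := Function.ne_iff.1 hv
    simp only [Pi.zero_apply] at hi
    have h0 : (H *ᵥ v) i = 0 := by
      have := key v i i
      have h3 : (Z *ᵥ v) i * (H *ᵥ v) i = 0 := by linear_combination this / 2
      exact (mul_eq_zero.1 h3).resolve_left hi
    ext j
    have := key v i j
    rw [h0, zero_mul, add_zero] at this
    exact (mul_eq_zero.1 this).resolve_left hi
  obtain ⟨w, hw⟩ : ∃ w, Z *ᵥ w ≠ 0 := by
    by_contra hcon
    push Not at hcon
    exact hZ (Matrix.ext_of_mulVec_single fun i => by rw [hcon, Matrix.zero_mulVec])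
  have hall : ∀ v, H *ᵥ v = 0 := by
    intro v
    by_cases hv : Z *ᵥ v = 0
    · have h1 := hker (v + w) (by rw [Matrix.mulVec_add, hv, zero_add]; exact hw)
      rwa [Matrix.mulVec_add, hker w hw, add_zero] at h1
    · exact hker v hv
  exact Matrix.ext_of_mulVec_single fun i => by rw [hall, Matrix.zero_mulVec]

end SymmetricSquare

/-! ### The family for `n ≥ 2`: symmetric square with a scalar block -/

section SquareFamily

open scoped Matrix.Norms.L2Operator

lemma sqNorm_sum {ι κ : Type*} [Fintype ι] [Fintype κ] (x : ι ⊕ κ → ℂ) :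
    sqNorm x = sqNorm (x ∘ Sum.inl) + sqNorm (x ∘ Sum.inr) := by
  simp [sqNorm, Fintype.sum_sum_type]

lemma sqNorm_comp_equiv {ι κ : Type*} [Fintype ι] [Fintype κ] (e : κ ≃ ι) (x : ι → ℂ) :
    sqNorm (x ∘ e) = sqNorm x := by
  simp only [sqNorm, Function.comp_apply]
  exact Equiv.sum_comp e fun i => ‖x i‖ ^ 2

lemma sqNorm_smul {ι : Type*} [Fintype ι] (c : ℂ) (x : ι → ℂ) :
    sqNorm (c • x) = ‖c‖ ^ 2 * sqNorm x := by
  simp [sqNorm, mul_pow, Finset.mul_sum]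

lemma norm_entry_le {n : ℕ} (Z : SymMat n) (i : Fin n) : ‖Z.1 i i‖ ≤ ‖Z‖ := by
  have h := norm_mulVec_le Z.1 (Pi.single i 1)
  have h1 : sqNorm (Pi.single i 1 : Fin n → ℂ) = 1 := by
    simp [sqNorm, Pi.single_apply, apply_ite]
  have h2 : ‖Z.1 i i‖ ^ 2 ≤ sqNorm (Z.1 *ᵥ Pi.single i 1) := by
    have := Finset.single_le_sum (f := fun j => ‖(Z.1 *ᵥ Pi.single i 1) j‖ ^ 2)
      (fun j _ => by positivity) (Finset.mem_univ i)
    simpa [sqNorm] using this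
  rw [h1, mul_one] at h
  exact (sq_le_sq₀ (norm_nonneg _) (norm_nonneg _)).1 (h2.trans h)

variable {n m k : ℕ} (e : Fin m ≃ Sym2 (Fin n) ⊕ Fin k) (i₀ : Fin n)

/-- The symmetric square of `Z` together with the scalar block `t * Z i₀ i₀`. -/
noncomputable def squareMap (t : ℝ) (Z : SymMat n) : SymMat m :=
  ⟨(Matrix.fromBlocks (symBil Z.1 Z.1) 0 0 ((t * Z.1 i₀ i₀ : ℂ) • 1)).submatrix e e, by
    have hZ : Z.1ᵀ = Z.1 := Z.2
    have h : (symBil Z.1 Z.1)ᵀ = symBil Z.1 Z.1 := by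
      rw [symBil, Matrix.transpose_mul, Matrix.transpose_mul, Matrix.transpose_transpose,
        ← Matrix.kroneckerMap_transpose, hZ, Matrix.mul_assoc]
    change (Matrix.submatrix _ e e)ᵀ = Matrix.submatrix _ e e
    rw [Matrix.transpose_submatrix, Matrix.fromBlocks_transpose, h]
    simp⟩

lemma sqNorm_submatrix_mulVec {ι κ : Type*} [Fintype ι] [Fintype κ] [DecidableEq κ]
    (f : Fin m ≃ ι ⊕ κ) (A : Matrix ι ι ℂ) (c : ℂ) (x : Fin m → ℂ) :
    sqNorm ((Matrix.fromBlocks A 0 0 (c • 1)).submatrix f f *ᵥ x) =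
      sqNorm (A *ᵥ (x ∘ f.symm ∘ Sum.inl)) + ‖c‖ ^ 2 * sqNorm (x ∘ f.symm ∘ Sum.inr) := by
  rw [Matrix.submatrix_mulVec_equiv, sqNorm_comp_equiv, Matrix.fromBlocks_mulVec, sqNorm_sum,
    Sum.elim_comp_inl, Sum.elim_comp_inr]
  simp only [Matrix.zero_mulVec, add_zero, zero_add, Matrix.smul_mulVec, Matrix.one_mulVec,
    sqNorm_smul, Function.comp_assoc]

lemma sqNorm_split {ι κ : Type*} [Fintype ι] [Fintype κ] (f : Fin m ≃ ι ⊕ κ) (x : Fin m → ℂ) :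
    sqNorm x = sqNorm (x ∘ f.symm ∘ Sum.inl) + sqNorm (x ∘ f.symm ∘ Sum.inr) := by
  rw [← sqNorm_comp_equiv f.symm x, sqNorm_sum, Function.comp_assoc, Function.comp_assoc]

lemma squareMap_mem {t : ℝ} (h0 : 0 ≤ t) (h1 : t ≤ 1) {Z : SymMat n} (hZ : Z ∈ OmegaIII n) :
    squareMap e i₀ t Z ∈ OmegaIII m := by
  rw [mem_OmegaIII_iff]
  intro x hx
  have hc : ‖(t * Z.1 i₀ i₀ : ℂ)‖ < 1 := by
    rw [norm_mul, Complex.norm_real, Real.norm_of_nonneg h0]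
    have h2 := (norm_entry_le Z i₀).trans_lt (mem_OmegaIII_iff_norm.1 hZ)
    nlinarith [norm_nonneg (Z.1 i₀ i₀)]
  have hc' : ‖(t * Z.1 i₀ i₀ : ℂ)‖ ^ 2 < 1 := pow_lt_one₀ (norm_nonneg _) hc two_ne_zero
  have hx' := sqNorm_pos hx
  change sqNorm (Matrix.submatrix _ e e *ᵥ x) < _
  rw [sqNorm_submatrix_mulVec, sqNorm_split e x]
  rw [sqNorm_split e x] at hx'
  by_cases ha : x ∘ e.symm ∘ Sum.inl = 0
  · rw [ha] at hx' ⊢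
    have hz : sqNorm (0 : Sym2 (Fin n) → ℂ) = 0 := sqNorm_eq_zero.2 rfl
    rw [hz] at hx'
    rw [Matrix.mulVec_zero, hz]
    nlinarith
  · have := sqNorm_symBil_mulVec_lt hZ ha
    nlinarith [sqNorm_nonneg (x ∘ e.symm ∘ Sum.inr)]

lemma squareMap_boundary (t : ℝ) {Z : SymMat n} (hZ : ‖Z‖ = 1) :
    squareMap e i₀ t Z ∉ OmegaIII m := by
  obtain ⟨v, hv, hZv⟩ := exists_mulVec_eq_star hZ
  -- The scalar block plays no part: the symmetric square of the Takagi vector, extended by zero,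
  -- keeps its length.
  let x : Fin m → ℂ := Sum.elim (symVec v) 0 ∘ e
  have ex : x ∘ e.symm ∘ Sum.inl = symVec v := by ext s; simp [x]
  have hx : x ≠ 0 := by
    intro h
    rw [h] at ex
    exact symVec_ne_zero hv ex.symm
  refine notMem_OmegaIII_of_le hx ?_
  have ex' : x ∘ e.symm ∘ Sum.inr = 0 := by ext s; simp [x]
  change _ ≤ sqNorm (Matrix.submatrix _ e e *ᵥ x)
  rw [sqNorm_submatrix_mulVec, sqNorm_split e x, ex, ex', sqNorm_symBil_symVec hZv,
    sqNorm_eq_zero.2 rfl, mul_zero]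

lemma differentiable_squareMap (t : ℝ) : Differentiable ℂ (squareMap e i₀ t) := by
  rw [← differentiableOn_univ]
  refine differentiableOn_of_entry fun i j => Differentiable.differentiableOn ?_
  change Differentiable ℂ fun Z : SymMat n =>
    Matrix.fromBlocks (symBil Z.1 Z.1) 0 0 ((t * Z.1 i₀ i₀ : ℂ) • 1) (e i) (e j)
  rcases e i with a | a <;> rcases e j with b | b
  · simp only [Matrix.fromBlocks_apply₁₁, symBil, Matrix.mul_apply, Matrix.kroneckerMap_apply,
      ← entryCLM_apply]
    fun_prop
  · simp
  · simp
  · simp only [Matrix.fromBlocks_apply₂₂, Matrix.smul_apply, ← entryCLM_apply]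
    fun_prop

lemma fderiv_squareMap (t : ℝ) (Z H : SymMat n) :
    (fderiv ℂ (squareMap e i₀ t) Z H).1 = (Matrix.fromBlocks
      (symBil Z.1 H.1 + symBil H.1 Z.1) 0 0 ((t * H.1 i₀ i₀ : ℂ) • 1)).submatrix e e := by
  have hd : ((1 / 2 : ℂ) • (squareMap e i₀ t (Z + H) - squareMap e i₀ t (Z - H))).1 =
      (Matrix.fromBlocks (symBil Z.1 H.1 + symBil H.1 Z.1) 0 0
        ((t * H.1 i₀ i₀ : ℂ) • 1)).submatrix e e := by
    ext i j
    change (1 / 2 : ℂ) *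
      (Matrix.fromBlocks (symBil (Z.1 + H.1) (Z.1 + H.1)) 0 0 _ (e i) (e j) -
        Matrix.fromBlocks (symBil (Z.1 - H.1) (Z.1 - H.1)) 0 0 _ (e i) (e j)) =
      Matrix.fromBlocks _ _ _ _ (e i) (e j)
    rcases e i with a | a <;> rcases e j with b | b <;>
      simp [sub_eq_add_neg, symBil_add_left, symBil_add_right, symBil_neg_left,
        symBil_neg_right] <;> ring
  rw [← hd]
  congr 1
  refine fderiv_apply_of_quadratic
    (q := (1 / 2 : ℂ) • (squareMap e i₀ t (Z + H) + squareMap e i₀ t (Z - H)) - squareMap e i₀ t Z)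
    (differentiable_squareMap e i₀ t Z) fun c => ?_
  refine SymMat.ext_entry fun i j => ?_
  simp only [Submodule.coe_add, Submodule.coe_smul, Matrix.add_apply, Matrix.smul_apply, hd,
    Submodule.coe_sub, Matrix.sub_apply]
  simp only [squareMap, Matrix.submatrix_apply, Submodule.coe_add,
    Submodule.coe_smul, sub_eq_add_neg]
  rcases e i with a | a <;> rcases e j with b | b <;>
    simp [symBil_add_left, symBil_add_right, symBil_smul_left, symBil_smul_right,
      symBil_neg_left, symBil_neg_right] <;> ring

/-- The symmetric matrix with a single diagonal entry one. -/
def diagUnit (i : Fin n) : SymMat n :=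
  ⟨Matrix.single i i 1, Matrix.transpose_single _ _ _⟩

lemma squareMap_zero (t : ℝ) : squareMap e i₀ t 0 = 0 := by
  refine SymMat.ext_entry fun i j => ?_
  have h : symBil (0 : Matrix (Fin n) (Fin n) ℂ) 0 = 0 := by simp [symBil]
  change Matrix.fromBlocks (symBil (0 : Matrix (Fin n) (Fin n) ℂ) 0) 0 0
    ((t * 0 : ℂ) • 1) (e i) (e j) = 0
  rw [h]
  simp

/-- At the origin only `t H i₀ i₀` remains of the derivative, so a second diagonal index supplies a
kernel; this is where `n ≥ 2` is needed. Elsewhere the polarized square alone is injective. -/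
lemma fderiv_squareMap_injective_iff (hn : ∃ j : Fin n, j ≠ i₀) (t : ℝ) (Z : SymMat n) :
    Function.Injective (fderiv ℂ (squareMap e i₀ t) Z) ↔ Z ≠ 0 := by
  constructor
  · rintro hinj rfl
    obtain ⟨j, hj⟩ := hn
    have hz : fderiv ℂ (squareMap e i₀ t) 0 (diagUnit j) = 0 := by
      refine Subtype.ext ?_
      rw [fderiv_squareMap]
      have h1 : ∀ W : Matrix (Fin n) (Fin n) ℂ, symBil (0 : Matrix (Fin n) (Fin n) ℂ) W = 0 := by
        simp [symBil]
      have h2 : ∀ W : Matrix (Fin n) (Fin n) ℂ, symBil W (0 : Matrix (Fin n) (Fin n) ℂ) = 0 := by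
        simp [symBil]
      have h3 : (diagUnit j).1 i₀ i₀ = 0 := by simp [diagUnit, hj]
      rw [Submodule.coe_zero, h1, h2, h3]
      simp
    have h := hinj (hz.trans (map_zero _).symm)
    have := congrArg (fun W : SymMat n => W.1 j j) h
    simp [diagUnit] at this
  · intro hZ
    rw [injective_iff_map_eq_zero]
    intro H hH
    have h1 := congrArg Subtype.val hH
    rw [fderiv_squareMap] at h1
    refine Subtype.ext (eq_zero_of_symBil_add_eq_zero (Z := Z.1)
      (fun h => hZ (Subtype.ext h)) ?_)
    ext s s'
    have := congrFun (congrFun h1 (e.symm (Sum.inl s))) (e.symm (Sum.inl s'))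
    simpa using this

/-- The derivative at the origin is `t H i₀ i₀` times the identity on the second block. The index
`j₀` guarantees that this block is not empty. -/
lemma norm_fderiv_squareMap (j₀ : Fin k) {t : ℝ} (h0 : 0 ≤ t) :
    ‖fderiv ℂ (squareMap e i₀ t) 0‖ = t := by
  have hD : ∀ (H : SymMat n) (x : Fin m → ℂ),
      sqNorm ((fderiv ℂ (squareMap e i₀ t) 0 H).1 *ᵥ x) =
        ‖(t * H.1 i₀ i₀ : ℂ)‖ ^ 2 * sqNorm (x ∘ e.symm ∘ Sum.inr) := by
    intro H x
    have h1 : symBil (0 : SymMat n).1 H.1 + symBil H.1 (0 : SymMat n).1 = 0 := by simp [symBil]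
    rw [fderiv_squareMap, h1, sqNorm_submatrix_mulVec, Matrix.zero_mulVec, sqNorm_eq_zero.2 rfl,
      zero_add]
  refine le_antisymm (ContinuousLinearMap.opNorm_le_bound _ h0 fun H => ?_) ?_
  · refine norm_le_of_sqNorm_mulVec_le _ (by positivity) fun x => ?_
    rw [hD, norm_mul, Complex.norm_real, Real.norm_of_nonneg h0]
    have h2 := norm_entry_le H i₀
    have h3 : sqNorm (x ∘ e.symm ∘ Sum.inr) ≤ sqNorm x := by
      rw [sqNorm_split e x]
      linarith [sqNorm_nonneg (x ∘ e.symm ∘ Sum.inl)]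
    have h4 := sqNorm_nonneg (x ∘ e.symm ∘ Sum.inr)
    gcongr
  · have hH : ‖diagUnit i₀‖ ≤ 1 := by
      refine norm_le_of_sqNorm_mulVec_le _ zero_le_one fun x => ?_
      rw [one_pow, one_mul]
      refine Finset.sum_le_sum fun i _ => ?_
      by_cases hi : i = i₀
      · subst hi; simp [diagUnit, Matrix.mulVec, dotProduct, Matrix.single_apply]
      · simp [diagUnit, Matrix.mulVec, dotProduct, Ne.symm hi]
    refine le_trans ?_ (ContinuousLinearMap.unit_le_opNorm _ (diagUnit i₀) hH)
    refine le_norm_of_le_sqNorm_mulVec _ (x := Sum.elim 0 (Pi.single j₀ 1) ∘ e) ?_ ?_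
    · intro h
      simpa using congrFun h (e.symm (Sum.inr j₀))
    · rw [hD, sqNorm_split e]
      have e1 : (Sum.elim (0 : Sym2 (Fin n) → ℂ) (Pi.single j₀ 1) ∘ e) ∘ e.symm ∘ Sum.inl = 0 := by
        ext s; simp
      rw [e1, sqNorm_eq_zero.2 rfl, zero_add]
      simp [diagUnit]

/-- Squaring maps with different parameters are inequivalent proper maps. -/
lemma exists_uncountable_of_equiv (e : Fin m ≃ Sym2 (Fin n) ⊕ Fin k) (i₀ : Fin n)
    (hn : ∃ j : Fin n, j ≠ i₀) (j₀ : Fin k) :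
    ∃ S : Set (OmegaIII n → OmegaIII m), ¬ S.Countable ∧
      (∀ f ∈ S, IsHolomorphicMap f ∧ IsProperBetween f) ∧
      S.Pairwise (fun f g => ¬ HolEquivalent f g) := by
  let h : Set.Icc (0 : ℝ) 1 → OmegaIII n → OmegaIII m := fun t Z =>
    ⟨squareMap e i₀ t Z, squareMap_mem e i₀ t.2.1 t.2.2 Z.2⟩
  have hne : ∀ s t, HolEquivalent (h s) (h t) → s = t := by
    intro s t hst
    have := hst.norm_fderiv_eq (F := squareMap e i₀ s) (G := squareMap e i₀ t) (fun _ => rfl)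
      (fun _ => rfl) (differentiable_squareMap e i₀ s).differentiableOn
      (differentiable_squareMap e i₀ t).differentiableOn
      (squareMap_zero e i₀ _) (squareMap_zero e i₀ _) (fderiv_squareMap_injective_iff e i₀ hn s)
      (fderiv_squareMap_injective_iff e i₀ hn t)
    rw [norm_fderiv_squareMap e i₀ j₀ s.2.1, norm_fderiv_squareMap e i₀ j₀ t.2.1] at this
    exact Subtype.ext this
  exact exists_uncountable_of_family h (fun hc => by
    exact not_le.2 one_pos (Cardinal.Real.Icc_countable_iff.1 (Set.countable_coe_iff.1 hc)))
    (fun t =>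
    ⟨⟨squareMap e i₀ t, (differentiable_squareMap e i₀ t).differentiableOn, fun _ => rfl⟩,
      isProperBetween_of_boundary (squareMap e i₀ t)
        (differentiable_squareMap e i₀ t).continuous.continuousOn
        (fun _ hZ => squareMap_boundary e i₀ t hZ) fun _ => rfl⟩) hne

end SquareFamily

/-! ### Blaschke products on the disc -/

section Disc

open Metric

/-- The finite Blaschke product `z ^ 3 (z - a) / (1 - a z)`. -/
noncomputable def cubicBlaschke (a : ℝ) (z : ℂ) : ℂ := z ^ 3 * (z - a) / (1 - a * z)

variable {a c : ℝ} {z : ℂ}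

lemma one_sub_mul_ne_zero (h0 : 0 < a) (h1 : a < 1) (hz : ‖z‖ ≤ 1) : 1 - a * z ≠ 0 := by
  intro h
  have h2 : ‖(a : ℂ) * z‖ = 1 := by rw [← sub_eq_zero.1 h]; simp
  rw [norm_mul, Complex.norm_real, Real.norm_of_nonneg h0.le] at h2
  nlinarith [norm_nonneg z]

lemma norm_sq_one_sub_mul_sub (a : ℝ) (z : ℂ) :
    ‖1 - a * z‖ ^ 2 - ‖z - a‖ ^ 2 = (1 - a ^ 2) * (1 - ‖z‖ ^ 2) := by
  simp only [← Complex.normSq_eq_norm_sq, Complex.normSq_apply]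
  simp
  ring

lemma norm_cubicBlaschke_lt (h0 : 0 < a) (h1 : a < 1) (hz : ‖z‖ < 1) :
    ‖cubicBlaschke a z‖ < 1 := by
  have hne := one_sub_mul_ne_zero h0 h1 hz.le
  have h := norm_sq_one_sub_mul_sub a z
  have h2 : ‖z - a‖ ≤ ‖1 - a * z‖ := by
    refine (sq_le_sq₀ (norm_nonneg _) (norm_nonneg _)).1 ?_
    have : 0 ≤ (1 - a ^ 2) * (1 - ‖z‖ ^ 2) :=
      mul_nonneg (by nlinarith) (by nlinarith [norm_nonneg z])
    linarith
  rw [cubicBlaschke, norm_div, norm_mul, norm_pow, div_lt_one (norm_pos_iff.2 hne)]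
  have h3 : ‖z‖ ^ 3 < 1 := pow_lt_one₀ (norm_nonneg _) hz (by norm_num)
  calc ‖z‖ ^ 3 * ‖z - a‖ ≤ ‖z‖ ^ 3 * ‖1 - a * z‖ := by gcongr
    _ < 1 * ‖1 - a * z‖ := mul_lt_mul_of_pos_right h3 (norm_pos_iff.2 hne)
    _ = _ := one_mul _

lemma norm_cubicBlaschke_eq_one (h0 : 0 < a) (h1 : a < 1) (hz : ‖z‖ = 1) :
    ‖cubicBlaschke a z‖ = 1 := by
  have hne := one_sub_mul_ne_zero h0 h1 hz.le
  have h := norm_sq_one_sub_mul_sub a z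
  rw [hz] at h
  have h2 : ‖z - a‖ = ‖1 - a * z‖ := by
    refine (pow_left_inj₀ (norm_nonneg _) (norm_nonneg _) two_ne_zero).1 ?_
    linarith
  rw [cubicBlaschke, norm_div, norm_mul, norm_pow, h2, hz, one_pow, one_mul,
    div_self (norm_ne_zero_iff.2 hne)]

lemma hasDerivAt_cubicBlaschke (hne : 1 - a * z ≠ 0) : HasDerivAt (cubicBlaschke a)
    (z ^ 2 * (-3 * a * z ^ 2 + (4 + 2 * a ^ 2) * z - 3 * a) / (1 - a * z) ^ 2) z := by
  have h1 : HasDerivAt (fun z : ℂ => z ^ 3 * (z - a)) (3 * z ^ 2 * (z - a) + z ^ 3) z := by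
    simpa using (hasDerivAt_pow 3 z).fun_mul ((hasDerivAt_id z).sub_const (a : ℂ))
  have h2 : HasDerivAt (fun z : ℂ => 1 - a * z) (-a) z := by
    simpa using ((hasDerivAt_id z).const_mul (a : ℂ)).const_sub 1
  convert! h1.div h2 hne using 1
  ring

lemma hasDerivAt_deriv_cubicBlaschke (h0 : 0 < a) (h1 : a < 1) (hz : z ∈ ball (0 : ℂ) 1) :
    HasDerivAt (deriv (cubicBlaschke a))
      (((2 * z * (-3 * a * z ^ 2 + (4 + 2 * a ^ 2) * z - 3 * a) +
        z ^ 2 * (-6 * a * z + (4 + 2 * a ^ 2))) * (1 - a * z) ^ 2 -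
        z ^ 2 * (-3 * a * z ^ 2 + (4 + 2 * a ^ 2) * z - 3 * a) * (2 * (1 - a * z) * (-a))) /
        ((1 - a * z) ^ 2) ^ 2) z := by
  have hne := one_sub_mul_ne_zero h0 h1 (mem_ball_zero_iff.1 hz).le
  have e : deriv (cubicBlaschke a) =ᶠ[nhds z] fun z =>
      z ^ 2 * (-3 * a * z ^ 2 + (4 + 2 * a ^ 2) * z - 3 * a) / (1 - a * z) ^ 2 := by
    filter_upwards [isOpen_ball.mem_nhds hz] with w hw
    exact (hasDerivAt_cubicBlaschke
      (one_sub_mul_ne_zero h0 h1 (mem_ball_zero_iff.1 hw).le)).deriv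
  refine HasDerivAt.congr_of_eventuallyEq ?_ e
  have d1 : HasDerivAt (fun z : ℂ => -3 * a * z ^ 2 + (4 + 2 * a ^ 2) * z - 3 * a)
      (-6 * a * z + (4 + 2 * a ^ 2)) z := by
    have := (((hasDerivAt_pow 2 z).const_mul (-3 * a : ℂ)).add
      ((hasDerivAt_id z).const_mul (4 + 2 * a ^ 2 : ℂ))).sub_const (3 * a : ℂ)
    convert! this using 1
    simp; ring
  have d2 : HasDerivAt (fun z : ℂ => (1 - a * z) ^ 2) (2 * (1 - a * z) * (-a)) z := by
    have : HasDerivAt (fun z : ℂ => 1 - a * z) (-a) z := by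
      simpa using ((hasDerivAt_id z).const_mul (a : ℂ)).const_sub 1
    simpa using this.fun_pow 2
  have d3 : HasDerivAt (fun z : ℂ => z ^ 2) (2 * z) z := by simpa using hasDerivAt_pow 2 z
  exact (d3.mul d1).div d2 (pow_ne_zero 2 hne)

/-- The origin is the only critical point of order two of the Blaschke product. -/
lemma eq_zero_of_deriv_cubicBlaschke (h0 : 0 < a) (h1 : a < 1) (hz : z ∈ ball (0 : ℂ) 1)
    (hd : deriv (cubicBlaschke a) z = 0) (hdd : deriv (deriv (cubicBlaschke a)) z = 0) :
    z = 0 := by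
  have hne := one_sub_mul_ne_zero h0 h1 (mem_ball_zero_iff.1 hz).le
  have ha : (a : ℂ) ≠ 0 := by exact_mod_cast h0.ne'
  rw [(hasDerivAt_cubicBlaschke hne).deriv, div_eq_zero_iff] at hd
  rw [(hasDerivAt_deriv_cubicBlaschke h0 h1 hz).deriv, div_eq_zero_iff] at hdd
  have hd := hd.resolve_right (pow_ne_zero 2 hne)
  have hdd := hdd.resolve_right (pow_ne_zero 2 (pow_ne_zero 2 hne))
  by_contra hz0
  have hN := (mul_eq_zero.1 hd).resolve_left (pow_ne_zero 2 hz0)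
  rw [hN] at hdd
  have hN' : -6 * a * z + (4 + 2 * a ^ 2) = 0 := by
    have : (z ^ 2 * (1 - a * z) ^ 2) * (-6 * a * z + (4 + 2 * a ^ 2)) = 0 := by
      linear_combination hdd
    exact (mul_eq_zero.1 this).resolve_left (mul_ne_zero (pow_ne_zero 2 hz0) (pow_ne_zero 2 hne))
  -- A further critical point of order two would be a double root of a quadratic whose roots have
  -- product one, hence `±1`, outside the disc.
  have hz2 : z ^ 2 = 1 := by
    have : (3 * a : ℂ) * (z ^ 2 - 1) = 0 := by linear_combination hN - z * hN'
    exact sub_eq_zero.1 ((mul_eq_zero.1 this).resolve_left (mul_ne_zero (by norm_num) ha))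
  have : ‖z‖ ^ 2 = 1 := by rw [← norm_pow, hz2, norm_one]
  have := mem_ball_zero_iff.1 hz
  nlinarith [norm_nonneg z]

/-- One half of the comparison of parameters: `β` fixes the origin and sends the simple zero `a` to
the simple zero `c`, so the Schwarz lemma gives `c ≤ a`. -/
lemma cubicBlaschke_le_of_comp (ha0 : 0 < a) (ha1 : a < 1) (hc0 : 0 < c) (hc1 : c < 1)
    {α β : ℂ → ℂ} (dα : DifferentiableOn ℂ α (ball 0 1)) (dβ : DifferentiableOn ℂ β (ball 0 1))
    (mβ : Set.MapsTo β (ball 0 1) (ball 0 1))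
    (iα : Set.InjOn α (ball 0 1)) (iβ : Set.InjOn β (ball 0 1))
    (nα : ∀ z ∈ ball (0 : ℂ) 1, deriv α z ≠ 0) (nβ : ∀ z ∈ ball (0 : ℂ) 1, deriv β z ≠ 0)
    (h : ∀ z ∈ ball (0 : ℂ) 1, cubicBlaschke a z = α (cubicBlaschke c (β z))) : c ≤ a := by
  have mem0 : (0 : ℂ) ∈ ball (0 : ℂ) 1 := by simp
  have mc : ∀ z ∈ ball (0 : ℂ) 1, cubicBlaschke c z ∈ ball (0 : ℂ) 1 := fun z hz =>
    mem_ball_zero_iff.2 (norm_cubicBlaschke_lt hc0 hc1 (mem_ball_zero_iff.1 hz))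
  have dc : ∀ z ∈ ball (0 : ℂ) 1, DifferentiableAt ℂ (cubicBlaschke c) z := fun z hz =>
    (hasDerivAt_cubicBlaschke
      (one_sub_mul_ne_zero hc0 hc1 (mem_ball_zero_iff.1 hz).le)).differentiableAt
  have atα : ∀ z ∈ ball (0 : ℂ) 1, DifferentiableAt ℂ α z := fun z hz =>
    dα.differentiableAt (isOpen_ball.mem_nhds hz)
  have atβ : ∀ z ∈ ball (0 : ℂ) 1, DifferentiableAt ℂ β z := fun z hz =>
    dβ.differentiableAt (isOpen_ball.mem_nhds hz)
  have hder : ∀ z ∈ ball (0 : ℂ) 1, deriv (cubicBlaschke a) z =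
      deriv α (cubicBlaschke c (β z)) * deriv β z * deriv (cubicBlaschke c) (β z) := by
    intro z hz
    have e : cubicBlaschke a =ᶠ[nhds z] fun z => α (cubicBlaschke c (β z)) := by
      filter_upwards [isOpen_ball.mem_nhds hz] with w hw using h w hw
    rw [e.deriv_eq]
    have h1 := (dc _ (mβ hz)).hasDerivAt.comp z (atβ z hz).hasDerivAt
    have h2 := (atα _ (mc _ (mβ hz))).hasDerivAt.comp z h1
    rw [show (fun z => α (cubicBlaschke c (β z))) = α ∘ (cubicBlaschke c ∘ β) from rfl, h2.deriv]
    ring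
  have β0 : β 0 = 0 := by
    have da0 : deriv (cubicBlaschke a) 0 = 0 := by
      rw [(hasDerivAt_cubicBlaschke (by simp)).deriv]; simp
    have dda0 : deriv (deriv (cubicBlaschke a)) 0 = 0 := by
      rw [(hasDerivAt_deriv_cubicBlaschke ha0 ha1 mem0).deriv]; simp
    -- The factor `U = α'(…) β'` does not vanish, so the first two derivatives at the origin vanish
    -- only if those of the second Blaschke product vanish at `β 0`.
    have hU : deriv α (cubicBlaschke c (β 0)) * deriv β 0 ≠ 0 :=
      mul_ne_zero (nα _ (mc _ (mβ mem0))) (nβ _ mem0)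
    have hp : deriv (cubicBlaschke c) (β 0) = 0 := by
      have := hder 0 mem0
      rw [da0] at this
      exact (mul_eq_zero.1 this.symm).resolve_left hU
    refine eq_zero_of_deriv_cubicBlaschke hc0 hc1 (mβ mem0) hp ?_
    have hUd : DifferentiableAt ℂ (fun z => deriv α (cubicBlaschke c (β z)) * deriv β z) 0 := by
      have h1 : DifferentiableAt ℂ (deriv α) (cubicBlaschke c (β 0)) :=
        (dα.deriv isOpen_ball).differentiableAt (isOpen_ball.mem_nhds (mc _ (mβ mem0)))
      have h2 : DifferentiableAt ℂ (deriv β) 0 :=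
        (dβ.deriv isOpen_ball).differentiableAt (isOpen_ball.mem_nhds mem0)
      have h3 : DifferentiableAt ℂ (fun z => cubicBlaschke c (β z)) 0 :=
        (dc _ (mβ mem0)).comp 0 (atβ 0 mem0)
      exact (DifferentiableAt.comp 0 h1 h3).mul h2
    have h4 := hasDerivAt_deriv_cubicBlaschke hc0 hc1 (mβ mem0)
    rw [← h4.deriv] at h4
    have h5 := hUd.hasDerivAt.mul (h4.comp 0 (atβ 0 mem0).hasDerivAt)
    have e : deriv (cubicBlaschke a) =ᶠ[nhds 0] fun z =>
        deriv α (cubicBlaschke c (β z)) * deriv β z * deriv (cubicBlaschke c) (β z) := by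
      filter_upwards [isOpen_ball.mem_nhds mem0] with w hw using hder w hw
    have h6 := (h5.congr_of_eventuallyEq e).deriv
    simp only [Function.comp_apply] at h6
    rw [dda0, hp, mul_zero, zero_add] at h6
    exact (mul_eq_zero.1 ((mul_eq_zero.1 h6.symm).resolve_left hU)).resolve_right (nβ _ mem0)
  have c0 : cubicBlaschke c 0 = 0 := by simp [cubicBlaschke]
  have α0 : α 0 = 0 := by
    have := h 0 mem0
    rw [β0, c0] at this
    rw [← this]; simp [cubicBlaschke]
  have mema : (a : ℂ) ∈ ball (0 : ℂ) 1 := by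
    rw [mem_ball_zero_iff, Complex.norm_real, Real.norm_of_nonneg ha0.le]; exact ha1
  -- As `α` is injective and fixes the origin, zeros correspond to zeros under `β`.
  have hca : cubicBlaschke c (β a) = 0 := by
    refine iα (mc _ (mβ mema)) mem0 ?_
    rw [← h _ mema, α0]; simp [cubicBlaschke]
  have hβa : β a ≠ 0 := by
    intro hβ
    have := iβ mema mem0 (hβ.trans β0.symm)
    exact ha0.ne' (by exact_mod_cast this)
  have hβc : β a = c := by
    rw [cubicBlaschke, div_eq_zero_iff] at hca
    have h1 := hca.resolve_right
      (one_sub_mul_ne_zero hc0 hc1 (mem_ball_zero_iff.1 (mβ mema)).le)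
    exact sub_eq_zero.1 ((mul_eq_zero.1 h1).resolve_left (pow_ne_zero 3 hβa))
  have hs := Complex.norm_le_norm_of_mapsTo_ball dβ
    (mβ.mono_right ball_subset_closedBall) β0 (mem_ball_zero_iff.1 mema)
  rw [hβc, Complex.norm_real, Complex.norm_real, Real.norm_of_nonneg hc0.le,
    Real.norm_of_nonneg ha0.le] at hs
  exact hs

end Disc

/-! ### Transfer between the disc and `OmegaIII 1` -/

section DiscFamily

open scoped Matrix.Norms.L2Operator
open Metric

lemma entry_smul_diagUnit (Z : SymMat 1) : Z.1 0 0 • diagUnit 0 = Z := by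
  refine SymMat.ext_entry fun i j => ?_
  fin_cases i; fin_cases j
  simp [diagUnit]

lemma smul_diagUnit_entry (z : ℂ) : (z • diagUnit (0 : Fin 1)).1 0 0 = z := by
  simp [diagUnit]

lemma norm_symMat_one (Z : SymMat 1) : ‖Z‖ = ‖Z.1 0 0‖ := by
  refine le_antisymm (norm_le_of_sqNorm_mulVec_le _ (norm_nonneg _) fun x => ?_)
    (norm_entry_le Z 0)
  simp [sqNorm, Matrix.mulVec, dotProduct, mul_pow]

lemma smul_diagUnit_mem_iff {z : ℂ} :
    z • diagUnit (0 : Fin 1) ∈ OmegaIII 1 ↔ z ∈ ball (0 : ℂ) 1 := by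
  rw [mem_OmegaIII_iff_norm, norm_symMat_one, smul_diagUnit_entry, mem_ball_zero_iff]

/-- A holomorphic automorphism of the one-dimensional domain, as a function on the disc. -/
lemma IsHolomorphicAut.exists_disc {A : OmegaIII 1 ≃ OmegaIII 1} (hA : IsHolomorphicAut A) :
    ∃ α : ℂ → ℂ, DifferentiableOn ℂ α (ball 0 1) ∧ Set.MapsTo α (ball 0 1) (ball 0 1) ∧
      Set.InjOn α (ball 0 1) ∧ (∀ z ∈ ball (0 : ℂ) 1, deriv α z ≠ 0) ∧
      ∀ Z : OmegaIII 1, α (Z.1.1 0 0) = (A Z).1.1 0 0 := by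
  obtain ⟨g, dg, hg, ig, -⟩ := hA.exists_extension
  have hα : ∀ Z : OmegaIII 1, (g (Z.1.1 0 0 • diagUnit 0)).1 0 0 = (A Z).1.1 0 0 := fun Z => by
    rw [entry_smul_diagUnit, hg]
  have hder : ∀ z ∈ ball (0 : ℂ) 1, HasDerivAt (fun z : ℂ => (g (z • diagUnit 0)).1 0 0)
      (entryCLM 0 0 (fderiv ℂ g (z • diagUnit 0) (diagUnit 0))) z := by
    intro z hz
    have h1 : HasDerivAt (fun z : ℂ => z • diagUnit (0 : Fin 1)) (diagUnit 0) z := by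
      simpa using (hasDerivAt_id z).smul_const (diagUnit (0 : Fin 1))
    have h2 := (dg.differentiableAt
      ((isOpen_OmegaIII 1).mem_nhds (smul_diagUnit_mem_iff.2 hz))).hasFDerivAt
    exact (entryCLM 0 0).hasFDerivAt.comp_hasDerivAt z (h2.comp_hasDerivAt z h1)
  refine ⟨fun z => (g (z • diagUnit 0)).1 0 0, fun z hz =>
    (hder z hz).differentiableAt.differentiableWithinAt, fun z hz => ?_, fun z hz w hw hzw => ?_,
    fun z hz => ?_, hα⟩
  · have := hα ⟨_, smul_diagUnit_mem_iff.2 hz⟩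
    simp only [smul_diagUnit_entry] at this
    simp only [this]
    rw [mem_ball_zero_iff, ← norm_symMat_one, ← mem_OmegaIII_iff_norm]
    exact (A _).2
  · have h1 := hα ⟨_, smul_diagUnit_mem_iff.2 hz⟩
    have h2 := hα ⟨_, smul_diagUnit_mem_iff.2 hw⟩
    simp only [smul_diagUnit_entry] at h1 h2 hzw
    rw [h1, h2] at hzw
    have h3 := A.injective (Subtype.ext ((entry_smul_diagUnit _).symm.trans
      ((congrArg (fun c : ℂ => c • diagUnit (0 : Fin 1)) hzw).trans (entry_smul_diagUnit _))))
    have h4 := congrArg (fun Z : OmegaIII 1 => Z.1.1 0 0) h3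
    simpa only [smul_diagUnit_entry] using h4
  · rw [(hder z hz).deriv]
    intro h0
    have h1 : fderiv ℂ g (z • diagUnit 0) (diagUnit 0) = 0 := by
      rw [← entry_smul_diagUnit (fderiv ℂ g (z • diagUnit 0) (diagUnit 0)), ← entryCLM_apply, h0,
        zero_smul]
    have h2 := ig ⟨_, smul_diagUnit_mem_iff.2 hz⟩ (h1.trans (map_zero _).symm)
    have h3 := congrArg (fun Z : SymMat 1 => Z.1 0 0) h2
    simp [diagUnit] at h3

/-- The Blaschke products as maps of the one-dimensional domain. -/
noncomputable def blaschkeMap (a : Set.Ioo (0 : ℝ) 1) (Z : OmegaIII 1) : OmegaIII 1 :=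
  ⟨cubicBlaschke a (Z.1.1 0 0) • diagUnit 0, smul_diagUnit_mem_iff.2 <| mem_ball_zero_iff.2 <|
    norm_cubicBlaschke_lt a.2.1 a.2.2 <| by
      rw [← norm_symMat_one, ← mem_OmegaIII_iff_norm]; exact Z.2⟩

lemma differentiableOn_blaschke (a : Set.Ioo (0 : ℝ) 1) :
    DifferentiableOn ℂ (fun Z : SymMat 1 => cubicBlaschke a (Z.1 0 0) • diagUnit (0 : Fin 1))
      (closedBall 0 1) := by
  intro Z hZ
  refine DifferentiableAt.differentiableWithinAt ?_
  have h1 : DifferentiableAt ℂ (cubicBlaschke a) (Z.1 0 0) :=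
    (hasDerivAt_cubicBlaschke (one_sub_mul_ne_zero a.2.1 a.2.2 (by
      rw [← norm_symMat_one]; simpa using hZ))).differentiableAt
  exact (DifferentiableAt.comp Z h1 (differentiable_entryCLM 0 0 Z)).smul_const _

lemma blaschkeMap_le {a c : Set.Ioo (0 : ℝ) 1} (h : HolEquivalent (blaschkeMap a) (blaschkeMap c)) :
    c ≤ a := by
  obtain ⟨B, A, hB, hA, hAB⟩ := h
  obtain ⟨α, dα, mα, iα, nα, hα⟩ := hA.exists_disc
  obtain ⟨β, dβ, mβ, iβ, nβ, hβ⟩ := hB.exists_disc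
  refine cubicBlaschke_le_of_comp a.2.1 a.2.2 c.2.1 c.2.2 dα dβ mβ iα iβ nα nβ fun z hz => ?_
  have h1 := congrArg (fun Z : OmegaIII 1 => Z.1.1 0 0)
    (congrFun hAB ⟨_, smul_diagUnit_mem_iff.2 hz⟩)
  have h2 := hβ ⟨_, smul_diagUnit_mem_iff.2 hz⟩
  simp only [Function.comp_apply, ← hα] at h1
  simp only [blaschkeMap, smul_diagUnit_entry, ← h2] at h1
  exact h1

lemma exists_uncountable_disc :
    ∃ S : Set (OmegaIII 1 → OmegaIII 1), ¬ S.Countable ∧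
      (∀ f ∈ S, IsHolomorphicMap f ∧ IsProperBetween f) ∧
      S.Pairwise (fun f g => ¬ HolEquivalent f g) := by
  refine exists_uncountable_of_family blaschkeMap (fun hc => ?_) (fun a => ⟨⟨_,
    (differentiableOn_blaschke a).mono ?_, fun _ => rfl⟩,
    isProperBetween_of_boundary _ (differentiableOn_blaschke a).continuousOn
      (fun Z hZ => ?_) fun _ => rfl⟩) fun a c h => le_antisymm (blaschkeMap_le h.symm)
        (blaschkeMap_le h)
  · exact not_le.2 one_pos (Cardinal.Real.Ioo_countable_iff.1 (Set.countable_coe_iff.1 hc))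
  · rw [OmegaIII_eq_ball]; exact ball_subset_closedBall
  · rw [mem_OmegaIII_iff_norm, norm_symMat_one, smul_diagUnit_entry,
      norm_cubicBlaschke_eq_one a.2.1 a.2.2 (by rw [← norm_symMat_one]; exact hZ)]
    exact lt_irrefl _

end DiscFamily

/-! ### Assembly of the cases -/

theorem mainTheorem4 :
    (∀ n : ℕ, 1 ≤ n →
      ∃ S : Set (OmegaIII n → OmegaIII ((n ^ 2 + 3 * n - 2) / 2)),
        ¬ S.Countable ∧
        (∀ f ∈ S, IsHolomorphicMap f ∧ IsProperBetween f) ∧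
        S.Pairwise (fun f g => ¬ HolEquivalent f g)) ∧
    (∃ h : Set.Icc (0 : ℝ) 1 → OmegaIII 2 → OmegaIII 4,
      (∀ (t : Set.Icc (0 : ℝ) 1) (Z : OmegaIII 2),
        ((h t Z : SymMat 4) : Matrix (Fin 4) (Fin 4) ℂ) =
          fMap t ((Z : SymMat 2) : Matrix (Fin 2) (Fin 2) ℂ)) ∧
      (∀ t, IsHolomorphicMap (h t) ∧ IsProperBetween (h t)) ∧
      (∀ s t, s ≠ t → ¬ HolEquivalent (h s) (h t))) := by
  refine ⟨fun n hn => ?_, fMapOmega, fun _ _ => rfl, fun t =>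
    ⟨fMapOmega_isHolomorphicMap t, fMapOmega_isProperBetween t⟩,
    fun _ _ => fMapOmega_not_holEquivalent⟩
  rcases hn.eq_or_lt with rfl | hn
  · exact exists_uncountable_disc
  · obtain ⟨k, rfl⟩ : ∃ k, n = k + 2 := ⟨n - 2, by omega⟩
    -- With `n = k + 2`, the unordered pairs number `n(n+1)/2`, leaving a scalar block of size `n -
    -- 1 = k + 1 > 0`.
    have hcard : ((k + 2) ^ 2 + 3 * (k + 2) - 2) / 2 = (k + 2 + 1).choose 2 + (k + 1) := by
      rw [Nat.choose_two_right, ← Nat.add_mul_div_left _ _ two_pos]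
      congr 1
      rw [Nat.add_sub_cancel]
      ring_nf
      omega
    have e : Fin (((k + 2) ^ 2 + 3 * (k + 2) - 2) / 2) ≃ Sym2 (Fin (k + 2)) ⊕ Fin (k + 1) :=
      Fintype.equivOfCardEq (by simp [Sym2.card, hcard])
    exact exists_uncountable_of_equiv e 0 ⟨1, by simp⟩ 0
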